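/- Let $\mathbb{F}_q$ be a finite field with $q$ elements and odd characteristic, let $\chi$ be a non-trivial additive character of $\mathbb{F}_q$, and let $$S=\{(x_1,\dots,x_d)\in\mathbb{F}_q^d : x_d=x_1^2+\cdots+x_{d-1}^2\}$$ be the paraboloid. For $f:S\to\mathbb{C}$ put $(f\,d\sigma)^\vee(m)=\frac{1}{|S|}\sum_{x\in S}\chi(x\cdot m)f(x)$ for $m\in\mathbb{F}_q^d$, and $\|f\|_{L^p(S,d\sigma)}=\big(\frac1{|S|}\sum_{x\in S}|f(x)|^p\big)^{1/p}$; for $g:\mathbb{F}_q^d\to\mathbb{C}$ put $\|g\|_{L^r(\mathbb{F}_q^d,dm)}=\big(\sum_{m\in\mathbb{F}_q^d}|g(m)|^r\big)^{1/r}$ if $r<\infty$ and $\|g\|_{L^\infty(\mathbb{F}_q^d,dm)}=\max_m|g(m)|$. Let $R^*(p\to r)$ be the smallest constant such that $$\|(f\,d\sigma)^\vee\|_{L^r(\mathbb{F}_q^d,dm)}\le R^*(p\to r)\,\|f\|_{L^p(S,d\sigma)}\qquad\text{for all } f:S\to\mathbb{C}.$$ **Theorem.** Let $d\ge 4$ be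 even and let $\frac{2d^2}{d^2-2d+2}\le r\le\infty$. Then for every $\varepsilon>0$ there is a constant $C_\varepsilon>0$ (depending on $d$, $r$ and $\varepsilon$, but not on $\mathbb{F}_q$ or $\chi$) such that, for every finite field $\mathbb{F}_q$ of odd characteristic and every non-trivial additive character $\chi$ of $\mathbb{F}_q$, $$R^*(2\to r)\le C_\varepsilon\, q^{\varepsilon}.$$ -/

import Mathlib

open scoped NNReal ENNReal BigOperators

namespace FiniteFieldExtension

noncomputable section

/-- The `L^p` norm on a finite set with respect to counting measure:
`(∑ x, |f x| ^ p) ^ (1 / p)` for `1 ≤ p < ∞`, and the maximum of `|f|` for `p = ∞`. -/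
def lpCount {α : Type*} [Fintype α] (p : ℝ≥0∞) (f : α → ℂ) : ℝ :=
  if p = ∞ then ⨆ x, ‖f x‖ else (∑ x, ‖f x‖ ^ p.toReal) ^ (1 / p.toReal)

/-- The `L^p` norm on a finite set with respect to normalized counting measure:
`(|α|⁻¹ * ∑ x, |f x| ^ p) ^ (1 / p)` for `1 ≤ p < ∞`, and the maximum of `|f|` for `p = ∞`. -/
def lpAvg {α : Type*} [Fintype α] (p : ℝ≥0∞) (f : α → ℂ) : ℝ :=
  if p = ∞ then ⨆ x, ‖f x‖
  else ((Fintype.card α : ℝ)⁻¹ * ∑ x, ‖f x‖ ^ p.toReal) ^ (1 / p.toReal)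

/-- The inverse Fourier transform `(f dσ)^∨` of the measure `f dσ`, where `dσ` is the normalized
surface measure on `S ⊆ F ^ d`:
`(f dσ)^∨ (m) = |S|⁻¹ * ∑ x ∈ S, χ (x · m) * f x`. -/
def extension {F : Type*} [Field F] {d : ℕ} (χ : AddChar F ℂ)
    (S : Finset (Fin d → F)) (f : S → ℂ) (m : Fin d → F) : ℂ :=
  (S.card : ℂ)⁻¹ * ∑ x : S, χ ((x : Fin d → F) ⬝ᵥ m) * f x

/-- `R^*(p → r)`: the smallest constant `C ≥ 0` such that
`‖(f dσ)^∨‖_{L^r(F ^ d, dm)} ≤ C * ‖f‖_{L^p(S, dσ)}` for all `f : S → ℂ`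
(the value is `∞` if there is no such constant). -/
def extensionConst {F : Type*} [Field F] [Fintype F] {d : ℕ} (χ : AddChar F ℂ)
    (S : Finset (Fin d → F)) (p r : ℝ≥0∞) : ℝ≥0∞ :=
  ⨅ (C : ℝ≥0) (_ : ∀ f : S → ℂ, lpCount r (extension χ S f) ≤ (C : ℝ) * lpAvg p f), (C : ℝ≥0∞)

/-- The paraboloid `{x ∈ F ^ d : x_d = x_1 ^ 2 + ⋯ + x_{d-1} ^ 2}` (for `d ≥ 1`). -/
def paraboloid (F : Type*) [Field F] [Fintype F] [DecidableEq F] :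
    (d : ℕ) → Finset (Fin d → F)
  | 0 => ∅
  | n + 1 => Finset.univ.filter fun x => x (Fin.last n) = ∑ i : Fin n, x i.castSucc ^ 2

end

end FiniteFieldExtension

set_option linter.unusedSectionVars false

namespace FiniteFieldExtension

/-! ### Orthogonality of characters and quadratic Gauss sums. -/

section CharacterSums

variable {F : Type*} [Field F] [Fintype F] [DecidableEq F] {n : ℕ} {χ : AddChar F ℂ}

/-! Write `d = n + 1` with `n = 2k + 1` odd, and let `E` be a set of `N` frequencies. By duality,
the `ℓ¹` sum of the extension over `E` is controlled by the `L²` mass on the paraboloid of the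
transform of a 1-bounded function on `E`. It suffices that this mass is at most `7 q^n N^θ` with `θ
= 1 + 2(d-1)/d²` (`paraboloidMass_le`): this is a restricted-type bound whose critical exponent `1 /
(1 - θ/2)` is `2d²/(d²-2d+2)`. Removing the smallest values one at a time (`sum_rpow_le_harmonic`)
turns it into an `ℓ^r` bound, with a loss of order `log q` that `q^ε` absorbs.

Three mass bounds are combined. Plancherel gives `q^(n+1) N`, good for large `N`. Expanding the
square and using the Gauss sum decay `q^(n/2)` gives `q^n N + q^(n/2) N²`, needed only when `d = 4`
and `N < q²`. The rest comes from cutting `E` into horizontal slices: each slice interacts with the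
other slices through a kernel whose `L⁴` norm is governed by the additive energy of the slice lifted
to the paraboloid.

The energy bound `3(|A|³/q + q^k |A|²)` (`paraboloidEnergy_le`) counts rectangles: `x + y = z + w`
on the paraboloid forces `(z - x) ⬝ (w - x) = 0`. A nonisotropic side is handled by point–hyperplane
incidences; if both sides are isotropic, odd `n` makes the Gauss sum terms in the Fourier transform
of the cone cancel exactly. -/

lemma addChar_map_sum {ι : Type*} (χ : AddChar F ℂ) (s : Finset ι) (f : ι → F) :
    χ (∑ i ∈ s, f i) = ∏ i ∈ s, χ (f i) := by
  classical
  induction s using Finset.induction_on with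
  | empty => simp
  | insert a s ha ih => rw [Finset.sum_insert ha, Finset.prod_insert ha, χ.map_add_eq_mul, ih]

lemma card_field_pos : (0 : ℝ) < Fintype.card F := by exact_mod_cast Fintype.card_pos

lemma one_le_card_field : (1 : ℝ) ≤ Fintype.card F := by
  exact_mod_cast Nat.succ_le_of_lt Fintype.card_pos

lemma sum_addChar_mul (hχ : χ.IsPrimitive) (a : F) :
    ∑ x : F, χ (x * a) = if a = 0 then (Fintype.card F : ℂ) else 0 := by
  rw [AddChar.sum_mulShift a hχ]
  split_ifs <;> simp

lemma sum_pi_prod (f : Fin n → F → ℂ) :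
    ∑ v : Fin n → F, ∏ i, f i (v i) = ∏ i, ∑ x : F, f i x := by
  rw [Finset.prod_univ_sum, Fintype.piFinset_univ]

lemma sum_addChar_dot (hχ : χ.IsPrimitive) (a : Fin n → F) :
    ∑ v : Fin n → F, χ (v ⬝ᵥ a) = if a = 0 then (Fintype.card F : ℂ) ^ n else 0 := by
  simp only [dotProduct, addChar_map_sum]
  rw [sum_pi_prod (fun i x => χ (x * a i))]
  simp only [sum_addChar_mul hχ]
  split_ifs with h
  · subst h; simp
  · obtain ⟨i, hi⟩ := Function.ne_iff.1 h
    exact Finset.prod_eq_zero (Finset.mem_univ i) (by simpa using hi)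

lemma sum_addChar_dot_prod (hχ : χ.IsPrimitive) (a : Fin n → F) (b : F) :
    ∑ p : (Fin n → F) × F, χ (p.1 ⬝ᵥ a + p.2 * b) =
      if a = 0 ∧ b = 0 then (Fintype.card F : ℂ) ^ (n + 1) else 0 := by
  simp only [AddChar.map_add_eq_mul, Fintype.sum_prod_type, ← Finset.mul_sum, ← Finset.sum_mul,
    sum_addChar_dot hχ, sum_addChar_mul hχ]
  split_ifs <;> simp_all [pow_succ]

/-- The quadratic Gauss sum with parameter `t`. -/
noncomputable def quadGauss (χ : AddChar F ℂ) (t : F) : ℂ := ∑ x : F, χ (t * x ^ 2)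

lemma two_ne_zero_of_ringChar (hF : ringChar F ≠ 2) : (2 : F) ≠ 0 := Ring.two_ne_zero hF

/-- After the shift `x = y + h` the phase is linear in `y`, so only `h = 0` survives. -/
lemma norm_quadGauss_sq (hχ : χ.IsPrimitive) (hF : ringChar F ≠ 2) {t : F} (ht : t ≠ 0) :
    ‖quadGauss χ t‖ ^ 2 = Fintype.card F := by
  have h2 := two_ne_zero_of_ringChar hF
  have key : quadGauss χ t * (starRingEnd ℂ) (quadGauss χ t) = Fintype.card F := by
    unfold quadGauss
    rw [map_sum, Finset.sum_mul_sum, Finset.sum_comm]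
    calc ∑ y : F, ∑ x : F, χ (t * x ^ 2) * (starRingEnd ℂ) (χ (t * y ^ 2))
        = ∑ y : F, ∑ h : F, χ (t * h ^ 2) * χ (y * (2 * t * h)) := by
          refine Finset.sum_congr rfl fun y _ => ?_
          rw [← Equiv.sum_comp (Equiv.addRight y)]
          refine Finset.sum_congr rfl fun h _ => ?_
          rw [← AddChar.map_neg_eq_conj, ← AddChar.map_add_eq_mul, ← AddChar.map_add_eq_mul]
          congr 1
          simp only [Equiv.coe_addRight]
          ring
      _ = Fintype.card F := by
          rw [Finset.sum_comm]
          simp only [← Finset.mul_sum, sum_addChar_mul hχ]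
          simp [h2, ht]
  rw [Complex.mul_conj, Complex.normSq_eq_norm_sq] at key
  exact_mod_cast key

lemma norm_quadGauss (hχ : χ.IsPrimitive) (hF : ringChar F ≠ 2) {t : F} (ht : t ≠ 0) :
    ‖quadGauss χ t‖ = √(Fintype.card F) := by
  rw [← norm_quadGauss_sq hχ hF ht, Real.sqrt_sq (norm_nonneg _)]

lemma sum_addChar_quadratic_one (hF : ringChar F ≠ 2) {t : F} (ht : t ≠ 0) (a : F) :
    ∑ x : F, χ (t * x ^ 2 + x * a) = χ (-(a ^ 2 / (4 * t))) * quadGauss χ t := by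
  have h2 := two_ne_zero_of_ringChar hF
  have h4 : (4 : F) ≠ 0 := by
    have : (4 : F) = 2 * 2 := by norm_num
    rw [this]; exact mul_ne_zero h2 h2
  unfold quadGauss
  rw [Finset.mul_sum, ← Equiv.sum_comp (Equiv.subRight (a / (2 * t)))]
  refine Finset.sum_congr rfl fun x _ => ?_
  rw [← AddChar.map_add_eq_mul]
  congr 1
  simp only [Equiv.subRight_apply]
  field_simp
  ring

lemma sum_addChar_quadratic (hF : ringChar F ≠ 2) {t : F} (ht : t ≠ 0) (a : Fin n → F) :
    ∑ v : Fin n → F, χ (t * (v ⬝ᵥ v) + v ⬝ᵥ a) =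
      χ (-((a ⬝ᵥ a) / (4 * t))) * quadGauss χ t ^ n := by
  have h1 : ∀ v : Fin n → F, χ (t * (v ⬝ᵥ v) + v ⬝ᵥ a) =
      ∏ i, χ (t * v i ^ 2 + v i * a i) := by
    intro v
    rw [← addChar_map_sum]
    congr 1
    simp only [dotProduct, Finset.mul_sum, ← Finset.sum_add_distrib, sq]
  simp only [h1]
  rw [sum_pi_prod (fun i x => χ (t * x ^ 2 + x * a i))]
  simp only [sum_addChar_quadratic_one hF ht, Finset.prod_mul_distrib, ← addChar_map_sum]
  simp [dotProduct, Finset.sum_div, sq]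

/-- Scaling by a nonsquare changes the sign of the quadratic Gauss sum, so that odd powers
cancel. -/
lemma sum_quadGauss_pow_eq_zero (hχ : χ.IsPrimitive) (hF : ringChar F ≠ 2) (hn : Odd n)
    {c : F} (hc : c ≠ 0) :
    ∑ t ∈ Finset.univ.filter (fun t : F => t ≠ 0), quadGauss χ (t * c) ^ n = 0 := by
  obtain ⟨a, ha⟩ := FiniteField.exists_nonsquare hF
  have ha0 : a ≠ 0 := by rintro rfl; exact ha (IsSquare.zero)
  have hη : quadraticChar F a = -1 := quadraticChar_neg_one_iff_not_isSquare.2 ha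
  -- An element `y` has `1 + η(y)` square roots, `η` being the quadratic character, and the constant
  -- 1 contributes a vanishing linear sum.
  have hG : ∀ t : F, t ≠ 0 → quadGauss χ t = ∑ y : F, (quadraticChar F y : ℂ) * χ (t * y) := by
    intro t ht
    have h1 : quadGauss χ t = ∑ y : F, ((quadraticChar F y : ℂ) + 1) * χ (t * y) := by
      unfold quadGauss
      rw [← Finset.sum_fiberwise (s := Finset.univ) (g := fun x : F => x ^ 2)]
      refine Finset.sum_congr rfl fun y _ => ?_
      have h2 := quadraticChar_card_sqrts hF y
      rw [Finset.sum_congr rfl (g := fun _ => χ (t * y))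
        (fun x hx => by rw [(Finset.mem_filter.1 hx).2]), Finset.sum_const, nsmul_eq_mul]
      congr 1
      have h3 : (Finset.univ.filter fun x : F => x ^ 2 = y) = {x : F | x ^ 2 = y}.toFinset := by
        ext; simp
      rw [h3]
      exact_mod_cast h2
    rw [h1]
    simp only [add_mul, one_mul, Finset.sum_add_distrib]
    rw [add_eq_left]
    simp only [mul_comm t]
    rw [sum_addChar_mul hχ, if_neg ht]
  have hneg : ∀ t : F, t ≠ 0 → quadGauss χ (a * t) = - quadGauss χ t := by
    intro t ht
    rw [hG t ht, hG _ (mul_ne_zero ha0 ht), ← Equiv.sum_comp (Equiv.mulLeft₀ a ha0)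
      (fun y => (quadraticChar F y : ℂ) * χ (t * y)), ← Finset.sum_neg_distrib]
    refine Finset.sum_congr rfl fun y _ => ?_
    simp only [Equiv.mulLeft₀_apply, map_mul, hη]
    push_cast
    rw [show t * (a * y) = a * t * y by ring]
    ring
  set S := ∑ t ∈ Finset.univ.filter (fun t : F => t ≠ 0), quadGauss χ (t * c) ^ n with hS
  have : S = -S := by
    conv_lhs => rw [hS]
    rw [hS, ← Finset.sum_neg_distrib]
    symm
    refine Finset.sum_equiv (Equiv.mulLeft₀ a⁻¹ (inv_ne_zero ha0)) (by simp [ha0]) fun t ht => ?_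
    have ht0 : t ≠ 0 := (Finset.mem_filter.1 ht).2
    have := hneg (a⁻¹ * t * c) (by simp [ha0, ht0, hc])
    rw [show a * (a⁻¹ * t * c) = t * c by field_simp] at this
    simp only [Equiv.mulLeft₀_apply]
    rw [this, hn.neg_pow, neg_neg]
  exact self_eq_neg.1 this

end CharacterSums

/-! ### Second moments of exponential sums and hyperplane incidences. -/

section Energy

variable {F : Type*} [Field F] [Fintype F] [DecidableEq F] {n : ℕ} {χ : AddChar F ℂ}

lemma norm_sq_sum_addChar {ι : Type*} (χ : AddChar F ℂ) (I : Finset ι) (c : ι → ℂ) (φ : ι → F) :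
    ((‖∑ i ∈ I, c i * χ (φ i)‖ ^ 2 : ℝ) : ℂ) =
      ∑ i ∈ I, ∑ j ∈ I, c i * (starRingEnd ℂ) (c j) * χ (φ i - φ j) := by
  rw [← Complex.normSq_eq_norm_sq, ← Complex.mul_conj, map_sum, Finset.sum_mul_sum]
  refine Finset.sum_congr rfl fun i _ => Finset.sum_congr rfl fun j _ => ?_
  rw [map_mul, ← AddChar.map_neg_eq_conj, sub_eq_add_neg, AddChar.map_add_eq_mul]
  ring

/-- Orthogonality kills all pairs with different frequencies. Repeated frequencies are allowed:
indexed by points this is Plancherel, indexed by pairs of points it produces the additive energy. -/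
lemma sum_norm_sq_addChar_le (hχ : χ.IsPrimitive) {ι : Type*} (I : Finset ι)
    (c : ι → ℂ) (hc : ∀ i ∈ I, ‖c i‖ ≤ 1) (α : ι → Fin n → F) (β : ι → F) :
    ∑ p : (Fin n → F) × F, ‖∑ i ∈ I, c i * χ (p.1 ⬝ᵥ α i + p.2 * β i)‖ ^ 2 ≤
      (Fintype.card F : ℝ) ^ (n + 1) *
        ((I ×ˢ I).filter fun x => α x.1 = α x.2 ∧ β x.1 = β x.2).card := by
  have key : ((∑ p : (Fin n → F) × F, ‖∑ i ∈ I, c i * χ (p.1 ⬝ᵥ α i + p.2 * β i)‖ ^ 2 : ℝ) : ℂ) =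
      ∑ x ∈ (I ×ˢ I).filter (fun x => α x.1 = α x.2 ∧ β x.1 = β x.2),
        c x.1 * (starRingEnd ℂ) (c x.2) * (Fintype.card F : ℂ) ^ (n + 1) := by
    rw [Complex.ofReal_sum]
    simp only [norm_sq_sum_addChar]
    rw [Finset.sum_comm, Finset.sum_filter, Finset.sum_product]
    refine Finset.sum_congr rfl fun i _ => ?_
    rw [Finset.sum_comm]
    refine Finset.sum_congr rfl fun j _ => ?_
    rw [← Finset.mul_sum]
    have h := sum_addChar_dot_prod hχ (α i - α j) (β i - β j)
    simp only [sub_eq_zero] at h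
    rw [← mul_ite_zero, ← h]
    congr 1
    refine Finset.sum_congr rfl fun p _ => ?_
    congr 1
    rw [dotProduct_sub]
    ring
  have h0 : 0 ≤ ∑ p : (Fin n → F) × F, ‖∑ i ∈ I, c i * χ (p.1 ⬝ᵥ α i + p.2 * β i)‖ ^ 2 :=
    Finset.sum_nonneg fun _ _ => by positivity
  have h1 := congrArg norm key
  rw [Complex.norm_real, Real.norm_of_nonneg h0] at h1
  rw [h1]
  refine (norm_sum_le _ _).trans ?_
  rw [mul_comm, ← nsmul_eq_mul]
  refine Finset.sum_le_card_nsmul _ _ _ fun x hx => ?_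
  have hx' := Finset.mem_product.1 (Finset.mem_filter.1 hx).1
  have e1 := hc _ hx'.1
  have e2 := hc _ hx'.2
  rw [norm_mul, norm_mul, RCLike.norm_conj, norm_pow, Complex.norm_natCast]
  exact mul_le_of_le_one_left (by positivity) (mul_le_one₀ e1 (norm_nonneg _) e2)

lemma sum_addChar_eq_indicator (hχ : χ.IsPrimitive) (a : F) :
    (Fintype.card F : ℂ) * (if a = 0 then 1 else 0) = ∑ s : F, χ (s * a) := by
  rw [sum_addChar_mul hχ]; split_ifs <;> simp

lemma card_hyperplane (hχ : χ.IsPrimitive) {z : Fin n → F} (hz : z ≠ 0) (c : F) :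
    (Fintype.card F : ℝ) * (Finset.univ.filter fun y : Fin n → F => z ⬝ᵥ y = c).card =
      (Fintype.card F : ℝ) ^ n := by
  have key : (Fintype.card F : ℂ) * (Finset.univ.filter fun y : Fin n → F => z ⬝ᵥ y = c).card =
      (Fintype.card F : ℂ) ^ n := by
    rw [Finset.card_filter, Nat.cast_sum, Finset.mul_sum]
    calc ∑ y : Fin n → F, (Fintype.card F : ℂ) * ((if z ⬝ᵥ y = c then 1 else 0 : ℕ) : ℂ)
        = ∑ y : Fin n → F, ∑ s : F, χ (s * (-c)) * χ (y ⬝ᵥ (s • z)) := by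
          refine Finset.sum_congr rfl fun y _ => ?_
          have := sum_addChar_eq_indicator hχ (z ⬝ᵥ y - c)
          simp only [sub_eq_zero] at this
          push_cast
          rw [this]
          refine Finset.sum_congr rfl fun s _ => ?_
          rw [← AddChar.map_add_eq_mul, dotProduct_smul, dotProduct_comm y z, smul_eq_mul]
          congr 1
          ring
      _ = _ := by
          rw [Finset.sum_comm]
          simp only [← Finset.mul_sum, sum_addChar_dot hχ]
          rw [Finset.sum_eq_single 0]
          · simp
          · intro s _ hs
            simp [hs, hz]
          · simp
  exact_mod_cast key

lemma card_hyperplane_inter (hχ : χ.IsPrimitive) {z w : Fin n → F}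
    (h : ∀ s t : F, s • z + t • w = 0 → s = 0 ∧ t = 0) (c d : F) :
    (Fintype.card F : ℝ) ^ 2 *
      (Finset.univ.filter fun y : Fin n → F => z ⬝ᵥ y = c ∧ w ⬝ᵥ y = d).card =
      (Fintype.card F : ℝ) ^ n := by
  have key : (Fintype.card F : ℂ) ^ 2 *
      (Finset.univ.filter fun y : Fin n → F => z ⬝ᵥ y = c ∧ w ⬝ᵥ y = d).card =
      (Fintype.card F : ℂ) ^ n := by
    rw [Finset.card_filter, Nat.cast_sum, Finset.mul_sum]
    calc ∑ y : Fin n → F, (Fintype.card F : ℂ) ^ 2 *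
          ((if z ⬝ᵥ y = c ∧ w ⬝ᵥ y = d then 1 else 0 : ℕ) : ℂ)
        = ∑ y : Fin n → F, ∑ s : F, ∑ t : F,
            χ (s * (-c) + t * (-d)) * χ (y ⬝ᵥ (s • z + t • w)) := by
          refine Finset.sum_congr rfl fun y _ => ?_
          have h1 := sum_addChar_eq_indicator hχ (z ⬝ᵥ y - c)
          have h2 := sum_addChar_eq_indicator hχ (w ⬝ᵥ y - d)
          simp only [sub_eq_zero] at h1 h2
          have h3 := congrArg₂ (· * ·) h1 h2
          simp only [Finset.sum_mul_sum] at h3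
          trans ((Fintype.card F : ℂ) * (if z ⬝ᵥ y = c then 1 else 0)) *
            ((Fintype.card F : ℂ) * (if w ⬝ᵥ y = d then 1 else 0))
          · by_cases hc : z ⬝ᵥ y = c <;> by_cases hd : w ⬝ᵥ y = d <;>
              simp only [hc, hd, if_true, if_false, and_true, and_false, Nat.cast_one,
                Nat.cast_zero] <;> ring
          rw [h3]
          refine Finset.sum_congr rfl fun s _ => Finset.sum_congr rfl fun t _ => ?_
          rw [← AddChar.map_add_eq_mul, ← AddChar.map_add_eq_mul, dotProduct_add,
            dotProduct_smul, dotProduct_smul,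
            dotProduct_comm y z, dotProduct_comm y w, smul_eq_mul, smul_eq_mul]
          congr 1
          ring
      _ = _ := by
          rw [Finset.sum_comm]
          rw [Finset.sum_eq_single 0]
          · rw [Finset.sum_comm, Finset.sum_eq_single 0]
            · simp only [← Finset.mul_sum, sum_addChar_dot hχ]
              simp
            · intro t _ ht
              rw [← Finset.mul_sum, sum_addChar_dot hχ, if_neg, mul_zero]
              exact fun h' => ht (h _ _ h').2
            · simp
          · intro s _ hs
            rw [Finset.sum_comm]
            refine Finset.sum_eq_zero fun t _ => ?_
            rw [← Finset.mul_sum, sum_addChar_dot hχ, if_neg, mul_zero]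
            exact fun h' => hs (h _ _ h').1
          · simp
  exact_mod_cast key

/-- Second moment of the number of nonisotropic `z ∈ Z` with `z ⬝ y = z ⬝ z`. -/
lemma sum_sq_nonisotropic_le (hχ : χ.IsPrimitive) (Z : Finset (Fin n → F))
    (hZ : ∀ z ∈ Z, z ⬝ᵥ z ≠ 0) :
    (Fintype.card F : ℝ) *
      ∑ y : Fin n → F, (∑ z ∈ Z, ((if z ⬝ᵥ y = z ⬝ᵥ z then 1 else 0) -
        (Fintype.card F : ℝ)⁻¹)) ^ 2 ≤ (Fintype.card F : ℝ) ^ n * Z.card := by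
  have hq : (0 : ℝ) < Fintype.card F := card_field_pos
  set q : ℝ := (Fintype.card F : ℝ) with hqdef
  have hz0 : ∀ z ∈ Z, z ≠ 0 := by
    rintro z hz rfl
    exact hZ _ hz (by simp)
  have e : ∀ z ∈ Z, ∑ y : Fin n → F, (if z ⬝ᵥ y = z ⬝ᵥ z then (1 : ℝ) else 0) = q ^ n / q := by
    intro z hz
    rw [eq_div_iff hq.ne', mul_comm, ← card_hyperplane hχ (hz0 z hz) (z ⬝ᵥ z)]
    simp [hqdef]
  -- Covariances of distinct hyperplanes are never positive: linearly independent normals give zero,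
  -- and proportional ones give disjoint hyperplanes. Only the diagonal remains.
  have main : ∀ z ∈ Z, ∀ w ∈ Z, ∑ y : Fin n → F,
      (((if z ⬝ᵥ y = z ⬝ᵥ z then 1 else 0) - q⁻¹) * ((if w ⬝ᵥ y = w ⬝ᵥ w then 1 else 0) - q⁻¹))
      ≤ if z = w then q ^ n / q else 0 := by
    intro z hz w hw
    have expand : ∑ y : Fin n → F,
      (((if z ⬝ᵥ y = z ⬝ᵥ z then 1 else 0) - q⁻¹) * ((if w ⬝ᵥ y = w ⬝ᵥ w then 1 else 0) - q⁻¹))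
      = (Finset.univ.filter fun y : Fin n → F => z ⬝ᵥ y = z ⬝ᵥ z ∧ w ⬝ᵥ y = w ⬝ᵥ w).card
        - q ^ n / q ^ 2 := by
      calc _ = ∑ y : Fin n → F, ((if z ⬝ᵥ y = z ⬝ᵥ z ∧ w ⬝ᵥ y = w ⬝ᵥ w then 1 else 0)
            - q⁻¹ * (if z ⬝ᵥ y = z ⬝ᵥ z then 1 else 0) - q⁻¹ * (if w ⬝ᵥ y = w ⬝ᵥ w then 1 else 0)
            + q⁻¹ ^ 2) := by
            refine Finset.sum_congr rfl fun y _ => ?_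
            by_cases h1 : z ⬝ᵥ y = z ⬝ᵥ z <;> by_cases h2 : w ⬝ᵥ y = w ⬝ᵥ w <;>
              simp only [h1, h2, if_true, if_false, and_true, and_false] <;> ring
        _ = _ := by
            rw [Finset.sum_add_distrib, Finset.sum_sub_distrib, Finset.sum_sub_distrib,
              ← Finset.mul_sum, ← Finset.mul_sum, e z hz, e w hw]
            simp only [Finset.sum_boole, Finset.sum_const, Finset.card_univ, Fintype.card_fun,
              Fintype.card_fin, nsmul_eq_mul, Nat.cast_pow, ← hqdef]
            field_simp
            ring
    rw [expand]
    split_ifs with hzw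
    · subst hzw
      have := e z hz
      simp only [Finset.sum_boole] at this
      simp only [and_self, this]
      have : 0 ≤ q ^ n / q ^ 2 := by positivity
      linarith
    · by_cases hind : ∀ s t : F, s • z + t • w = 0 → s = 0 ∧ t = 0
      · have := card_hyperplane_inter hχ hind (z ⬝ᵥ z) (w ⬝ᵥ w)
        rw [← hqdef] at this
        rw [← this]
        field_simp
        simp
      · rw [Finset.filter_false_of_mem]
        · simp; positivity
        · rintro y - ⟨h1, h2⟩
          -- A common point `y` of the two hyperplanes would force `s + t = 0` in the linear
          -- relation, hence `z = w`; nonisotropy is what excludes the other solutions.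
          push Not at hind
          obtain ⟨s, t, hst, hne⟩ := hind
          have hs : s • z = -(t • w) := eq_neg_of_add_eq_zero_left hst
          have k1 : s * (z ⬝ᵥ z) + t * (w ⬝ᵥ w) = 0 := by
            rw [← h1, ← h2, ← smul_eq_mul, ← smul_eq_mul, ← smul_dotProduct, ← smul_dotProduct,
              ← add_dotProduct, hst, zero_dotProduct]
          have k2 : s ^ 2 * (z ⬝ᵥ z) = t ^ 2 * (w ⬝ᵥ w) := by
            have := congrArg (fun v => v ⬝ᵥ v) hs
            simp only [smul_dotProduct, dotProduct_smul, neg_dotProduct, dotProduct_neg,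
              smul_eq_mul] at this
            linear_combination this
          have hw' := hZ w hw
          have hz' := hZ z hz
          have hs0 : s ≠ 0 := by
            rintro rfl
            have : t = 0 := by simpa [hw'] using k1
            exact hne rfl this
          have ht0 : t ≠ 0 := by
            rintro rfl
            have : s = 0 := by simpa [hz'] using k1
            exact hs0 this
          have k3 : t * (w ⬝ᵥ w) * (s + t) = 0 := by linear_combination s * k1 - k2
          have k4 : t = -s := by
            have : s + t = 0 := by simpa [ht0, hw'] using k3
            linear_combination this
          rw [k4, neg_smul, neg_neg] at hs
          exact hzw (smul_right_injective _ hs0 hs)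
  have : ∑ y : Fin n → F, (∑ z ∈ Z, ((if z ⬝ᵥ y = z ⬝ᵥ z then 1 else 0) - q⁻¹)) ^ 2
      ≤ Z.card * (q ^ n / q) := by
    simp only [sq, Finset.sum_mul_sum]
    rw [Finset.sum_comm, ← nsmul_eq_mul]
    refine Finset.sum_le_card_nsmul _ _ _ fun z hz => ?_
    rw [Finset.sum_comm]
    refine (Finset.sum_le_sum (main z hz)).trans ?_
    rw [Finset.sum_ite_eq, if_pos hz]
  calc _ ≤ q * (Z.card * (q ^ n / q)) := by gcongr
    _ = _ := by field_simp

end Energy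

/-! ### Orthogonal pairs and the additive energy of the paraboloid. -/

section Energy

variable {F : Type*} [Field F] [Fintype F] [DecidableEq F] {n : ℕ} {χ : AddChar F ℂ}

/-- The mean incidence density `1/q` gives the first term; Cauchy–Schwarz with the second moment
bounds the deviation by `q^((n-1)/2) |B|`. -/
lemma card_nonisotropic_le (hχ : χ.IsPrimitive) {k : ℕ} (hn : n = 2 * k + 1)
    (B : Finset (Fin n → F)) :
    (((B ×ˢ B).filter fun p => p.1 ⬝ᵥ p.1 ≠ 0 ∧ p.1 ⬝ᵥ p.2 = p.1 ⬝ᵥ p.1).card : ℝ) ≤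
      (B.card : ℝ) ^ 2 / Fintype.card F + (Fintype.card F : ℝ) ^ k * B.card := by
  have hq : (0 : ℝ) < Fintype.card F := card_field_pos
  set q : ℝ := (Fintype.card F : ℝ) with hqdef
  set Z := B.filter fun z => z ⬝ᵥ z ≠ 0 with hZ
  have hZB : (Z.card : ℝ) ≤ B.card := by exact_mod_cast Finset.card_filter_le _ _
  have h2 := sum_sq_nonisotropic_le hχ Z (fun z hz => (Finset.mem_filter.1 hz).2)
  rw [← hqdef] at h2
  set D : (Fin n → F) → ℝ := fun y => ∑ z ∈ Z, ((if z ⬝ᵥ y = z ⬝ᵥ z then 1 else 0) - q⁻¹) with hD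
  have hcount : (((B ×ˢ B).filter fun p => p.1 ⬝ᵥ p.1 ≠ 0 ∧ p.1 ⬝ᵥ p.2 = p.1 ⬝ᵥ p.1).card : ℝ)
      = ∑ y ∈ B, D y + Z.card * B.card / q := by
    have : ∑ y ∈ B, D y = ∑ y ∈ B, ∑ z ∈ Z, (if z ⬝ᵥ y = z ⬝ᵥ z then (1 : ℝ) else 0)
        - Z.card * B.card / q := by
      simp only [hD, Finset.sum_sub_distrib, Finset.sum_const, nsmul_eq_mul]
      field_simp
    rw [this, sub_add_cancel, Finset.card_filter, Nat.cast_sum, Finset.sum_product,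
      Finset.sum_comm]
    refine Finset.sum_congr rfl fun y _ => ?_
    rw [hZ, Finset.sum_filter]
    refine Finset.sum_congr rfl fun z _ => ?_
    split_ifs <;> simp_all
  have hcs : (∑ y ∈ B, D y) ^ 2 ≤ (q ^ k * B.card) ^ 2 := by
    have h3 : ∑ y, D y ^ 2 ≤ q ^ (2 * k) * Z.card := by
      have hqn : q ^ n = q * q ^ (2 * k) := by rw [hn]; ring
      rw [hqn, mul_assoc] at h2
      exact le_of_mul_le_mul_left h2 hq
    calc (∑ y ∈ B, D y) ^ 2 ≤ B.card * ∑ y ∈ B, D y ^ 2 := sq_sum_le_card_mul_sum_sq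
      _ ≤ B.card * ∑ y, D y ^ 2 := by
          gcongr
          exact Finset.subset_univ _
      _ ≤ B.card * (q ^ (2 * k) * B.card) := by gcongr; exact h3.trans (by gcongr)
      _ = _ := by ring
  have h4 := abs_le_of_sq_le_sq' hcs (by positivity)
  rw [hcount, add_comm]
  refine add_le_add ?_ h4.2
  rw [sq]
  gcongr

/-- The Fourier transform of the cone is a point mass plus Gauss sum terms. Averaging over the
dilations `s` of the isotropic set cancels the latter when `n` is odd, leaving only the coincidences
`s • z = s' • z'`. -/
lemma sum_sq_isotropic_le (hχ : χ.IsPrimitive) (hF : ringChar F ≠ 2) (hn : Odd n)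
    (Z : Finset (Fin n → F)) (hZ : ∀ z ∈ Z, z ⬝ᵥ z = 0) :
    ∑ w ∈ Finset.univ.filter (fun w : Fin n → F => w ⬝ᵥ w = 0),
      ‖∑ i ∈ Finset.univ.filter (fun s : F => s ≠ 0) ×ˢ Z, χ (i.1 * (w ⬝ᵥ i.2))‖ ^ 2 ≤
      (Fintype.card F : ℝ) ^ (n + 1) * Z.card := by
  have hq : (0 : ℝ) < Fintype.card F := card_field_pos
  have h2 := two_ne_zero_of_ringChar hF
  set U := Finset.univ.filter (fun s : F => s ≠ 0) with hU
  set I := U ×ˢ Z with hI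
  have hcone : ∀ v : Fin n → F, (Fintype.card F : ℂ) *
      ∑ w ∈ Finset.univ.filter (fun w : Fin n → F => w ⬝ᵥ w = 0), χ (w ⬝ᵥ v) =
      (if v = 0 then (Fintype.card F : ℂ) ^ n else 0) +
        ∑ t ∈ U, χ (-((v ⬝ᵥ v) / (4 * t))) * quadGauss χ t ^ n := by
    intro v
    calc _ = ∑ t : F, ∑ w : Fin n → F, χ (t * (w ⬝ᵥ w) + w ⬝ᵥ v) := by
          rw [Finset.sum_comm, Finset.sum_filter, Finset.mul_sum]
          refine Finset.sum_congr rfl fun w _ => ?_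
          simp only [AddChar.map_add_eq_mul, ← Finset.sum_mul, ← sum_addChar_eq_indicator hχ]
          split_ifs <;> simp
      _ = _ := by
          rw [← Finset.sum_filter_add_sum_filter_not Finset.univ (fun t : F => t ≠ 0), add_comm,
            ← hU]
          congr 1
          · have : Finset.univ.filter (fun t : F => ¬ t ≠ 0) = {0} := by ext; simp
            rw [this, Finset.sum_singleton, ← sum_addChar_dot hχ]
            simp
          · exact Finset.sum_congr rfl fun t ht =>
              sum_addChar_quadratic hF (Finset.mem_filter.1 ht).2 v
  have hgauss : ∀ z ∈ Z, ∀ z' ∈ Z, ∑ s ∈ U, ∑ s' ∈ U, ∑ t ∈ U,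
      χ (-(((s • z - s' • z') ⬝ᵥ (s • z - s' • z')) / (4 * t))) * quadGauss χ t ^ n = 0 := by
    intro z hz z' hz'
    rw [Finset.sum_comm]
    refine Finset.sum_eq_zero fun s' hs' => ?_
    have e : ∀ s ∈ U, ∑ t ∈ U,
        χ (-(((s • z - s' • z') ⬝ᵥ (s • z - s' • z')) / (4 * t))) * quadGauss χ t ^ n
        = ∑ t ∈ U, χ (2 * s' * (z ⬝ᵥ z') / (4 * t)) * quadGauss χ (s * t) ^ n := by
      intro s hs
      have hs0 : s ≠ 0 := (Finset.mem_filter.1 hs).2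
      symm
      -- By isotropy the quadratic form at `s • z - s' • z'` is `-2ss'(z ⬝ z')`. Replacing `t` by
      -- `st` moves `s` out of the phase and into the Gauss sum alone, whose odd powers then sum to
      -- zero over `s`.
      refine Finset.sum_equiv (Equiv.mulLeft₀ s hs0) (by simp [hU, hs0]) fun t ht => ?_
      simp only [Equiv.mulLeft₀_apply]
      congr 2
      simp only [sub_dotProduct, dotProduct_sub, smul_dotProduct, dotProduct_smul, smul_eq_mul,
        hZ z hz, hZ z' hz', dotProduct_comm z' z]
      rw [mul_left_comm 4 s t, ← mul_div_mul_left (2 * s' * (z ⬝ᵥ z')) (4 * t) hs0]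
      ring
    rw [Finset.sum_congr rfl e, Finset.sum_comm]
    refine Finset.sum_eq_zero fun t ht => ?_
    rw [← Finset.mul_sum, sum_quadGauss_pow_eq_zero hχ hF hn (Finset.mem_filter.1 ht).2, mul_zero]
  have key : ((Fintype.card F * ∑ w ∈ Finset.univ.filter (fun w : Fin n → F => w ⬝ᵥ w = 0),
      ‖∑ i ∈ I, χ (i.1 * (w ⬝ᵥ i.2))‖ ^ 2 : ℝ) : ℂ) =
      ((Fintype.card F : ℝ) ^ n *
        ((I ×ˢ I).filter fun x => x.1.1 • x.1.2 = x.2.1 • x.2.2).card : ℝ) := by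
    have e1 : ∀ w : Fin n → F, ((‖∑ i ∈ I, χ (i.1 * (w ⬝ᵥ i.2))‖ ^ 2 : ℝ) : ℂ) =
        ∑ i ∈ I, ∑ j ∈ I, χ (w ⬝ᵥ (i.1 • i.2 - j.1 • j.2)) := by
      intro w
      have := norm_sq_sum_addChar χ I (fun _ => 1) (fun i => i.1 * (w ⬝ᵥ i.2))
      simp only [one_mul, map_one] at this
      rw [this]
      simp only [dotProduct_sub, dotProduct_smul, smul_eq_mul]
    push_cast
    push_cast at e1
    simp only [e1]
    rw [Finset.sum_comm, Finset.mul_sum]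
    calc _ = ∑ i ∈ I, ∑ j ∈ I, ((if i.1 • i.2 - j.1 • j.2 = 0 then (Fintype.card F : ℂ) ^ n else 0)
          + ∑ t ∈ U, χ (-(((i.1 • i.2 - j.1 • j.2) ⬝ᵥ (i.1 • i.2 - j.1 • j.2)) / (4 * t))) *
            quadGauss χ t ^ n) := by
          refine Finset.sum_congr rfl fun i _ => ?_
          rw [Finset.sum_comm, Finset.mul_sum]
          exact Finset.sum_congr rfl fun j _ => hcone _
      _ = _ := by
          simp only [Finset.sum_add_distrib]
          have z0 : ∑ i ∈ I, ∑ j ∈ I, ∑ t ∈ U,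
            χ (-(((i.1 • i.2 - j.1 • j.2) ⬝ᵥ (i.1 • i.2 - j.1 • j.2)) / (4 * t))) *
            quadGauss χ t ^ n = 0 := by
            rw [hI, Finset.sum_product_right]
            refine Finset.sum_eq_zero fun z hz => ?_
            simp only [Finset.sum_product_right (s := U) (t := Z)]
            rw [Finset.sum_comm]
            exact Finset.sum_eq_zero fun z' hz' => hgauss z hz z' hz'
          rw [z0, add_zero, ← Finset.sum_product', ← Finset.sum_filter, Finset.sum_const,
            nsmul_eq_mul, mul_comm]
          simp only [sub_eq_zero]
  -- A coincidence is determined by `s'`, `s` and `z`, because `s' ≠ 0`.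
  have hcard : ((I ×ˢ I).filter fun x => x.1.1 • x.1.2 = x.2.1 • x.2.2).card ≤
      ((Finset.univ : Finset F) ×ˢ ((Finset.univ : Finset F) ×ˢ Z)).card := by
    refine Finset.card_le_card_of_injOn (fun x => (x.2.1, x.1)) ?_ ?_
    · rintro ⟨⟨s, z⟩, ⟨s', z'⟩⟩ hx
      simp only [Finset.coe_filter, Finset.mem_product, Set.mem_ofPred_eq, hI] at hx
      simp [hx.1.1.2]
    · rintro ⟨⟨s, z⟩, ⟨s', z'⟩⟩ hx ⟨⟨t, y⟩, ⟨t', y'⟩⟩ hy hxy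
      simp only [Finset.coe_filter, Finset.mem_product, Set.mem_ofPred_eq, hI, hU,
        Finset.mem_filter] at hx hy
      simp only [Prod.mk.injEq] at hxy ⊢
      obtain ⟨rfl, rfl, rfl⟩ := hxy
      refine ⟨⟨rfl, rfl⟩, rfl, ?_⟩
      have := hx.2.symm.trans hy.2
      exact smul_right_injective _ hx.1.2.1.2 this
  have key' : (Fintype.card F : ℝ) * ∑ w ∈ Finset.univ.filter (fun w : Fin n → F => w ⬝ᵥ w = 0),
      ‖∑ i ∈ I, χ (i.1 * (w ⬝ᵥ i.2))‖ ^ 2 =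
      (Fintype.card F : ℝ) ^ n *
        ((I ×ˢ I).filter fun x => x.1.1 • x.1.2 = x.2.1 • x.2.2).card := by exact_mod_cast key
  refine le_of_mul_le_mul_left (a := (Fintype.card F : ℝ)) ?_ hq
  rw [key']
  have hcard' : (((I ×ˢ I).filter fun x => x.1.1 • x.1.2 = x.2.1 • x.2.2).card : ℝ) ≤
      Fintype.card F * (Fintype.card F * Z.card) := by
    rw [Finset.card_product, Finset.card_product, Finset.card_univ] at hcard
    exact_mod_cast hcard
  calc _ ≤ (Fintype.card F : ℝ) ^ n * (Fintype.card F * (Fintype.card F * Z.card)) := by gcongr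
    _ = _ := by ring

/-- Detect orthogonality by characters: the trivial one gives `|Z|²/q`. For the others,
Cauchy–Schwarz is enlarged from `Z` to the cone, where the second moment is under control. -/
lemma card_isotropic_le (hχ : χ.IsPrimitive) (hF : ringChar F ≠ 2) {k : ℕ} (hn : n = 2 * k + 1)
    (B : Finset (Fin n → F)) :
    (((B ×ˢ B).filter fun p => p.1 ⬝ᵥ p.1 = 0 ∧ p.2 ⬝ᵥ p.2 = 0 ∧ p.1 ⬝ᵥ p.2 = 0).card : ℝ) ≤
      (B.card : ℝ) ^ 2 / Fintype.card F + (Fintype.card F : ℝ) ^ k * B.card := by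
  have hq : (0 : ℝ) < Fintype.card F := card_field_pos
  set Z := B.filter fun z => z ⬝ᵥ z = 0 with hZ
  have hZB : (Z.card : ℝ) ≤ B.card := by exact_mod_cast Finset.card_filter_le _ _
  have h2 := sum_sq_isotropic_le hχ hF ⟨k, hn⟩ Z (fun z hz => (Finset.mem_filter.1 hz).2)
  set U := Finset.univ.filter (fun s : F => s ≠ 0) with hU
  set D : (Fin n → F) → ℂ := fun w => ∑ i ∈ U ×ˢ Z, χ (i.1 * (w ⬝ᵥ i.2)) with hD
  set P := ((B ×ˢ B).filter fun p => p.1 ⬝ᵥ p.1 = 0 ∧ p.2 ⬝ᵥ p.2 = 0 ∧ p.1 ⬝ᵥ p.2 = 0).card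
  have hcount : (Fintype.card F : ℂ) * P = ∑ w ∈ Z, D w + (Z.card : ℂ) * Z.card := by
    have hP : P = ((Z ×ˢ Z).filter fun p => p.2 ⬝ᵥ p.1 = 0).card := by
      refine congrArg Finset.card ?_
      ext p
      simp only [Finset.mem_filter, Finset.mem_product, hZ, dotProduct_comm p.2 p.1]
      tauto
    rw [hP, Finset.card_filter, Nat.cast_sum, Finset.sum_product_right, Finset.mul_sum,
      ← nsmul_eq_mul (Z.card), ← Finset.sum_const, ← Finset.sum_add_distrib]
    refine Finset.sum_congr rfl fun w _ => ?_
    simp only [hD]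
    rw [Finset.sum_product_right, Finset.mul_sum, Finset.cast_card, ← Finset.sum_add_distrib]
    refine Finset.sum_congr rfl fun z _ => ?_
    have := sum_addChar_eq_indicator hχ (w ⬝ᵥ z)
    push_cast
    rw [this, ← Finset.sum_filter_add_sum_filter_not Finset.univ (fun t : F => t ≠ 0), ← hU]
    congr 1
    have : Finset.univ.filter (fun t : F => ¬ t ≠ 0) = {0} := by ext; simp
    rw [this]
    simp
  have hcs : (∑ w ∈ Z, ‖D w‖) ^ 2 ≤ ((Fintype.card F : ℝ) ^ (k + 1) * B.card) ^ 2 := by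
    calc (∑ w ∈ Z, ‖D w‖) ^ 2 ≤ Z.card * ∑ w ∈ Z, ‖D w‖ ^ 2 := sq_sum_le_card_mul_sum_sq
      _ ≤ Z.card * ∑ w ∈ Finset.univ.filter (fun w : Fin n → F => w ⬝ᵥ w = 0), ‖D w‖ ^ 2 := by
          gcongr
          intro z hz
          simpa using (Finset.mem_filter.1 hz).2
      _ ≤ B.card * ((Fintype.card F : ℝ) ^ (n + 1) * B.card) := by
          gcongr
          exact h2.trans (by gcongr)
      _ = _ := by
          have hqn : (Fintype.card F : ℝ) ^ (n + 1) = (Fintype.card F : ℝ) ^ (2 * (k + 1)) := by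
            rw [hn]; ring
          rw [hqn]; ring
  have h4 := abs_le_of_sq_le_sq' hcs (by positivity)
  have h5 : (Fintype.card F : ℝ) * P ≤ ∑ w ∈ Z, ‖D w‖ + (Z.card : ℝ) * Z.card := by
    have := congrArg norm hcount
    rw [norm_mul, Complex.norm_natCast, Complex.norm_natCast] at this
    rw [this]
    refine (norm_add_le _ _).trans ?_
    rw [norm_mul, Complex.norm_natCast]
    gcongr
    exact norm_sum_le _ _
  have h6 : (Fintype.card F : ℝ) * P ≤
      Fintype.card F * ((B.card : ℝ) ^ 2 / Fintype.card F + (Fintype.card F : ℝ) ^ k * B.card) := by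
    refine h5.trans ?_
    calc _ ≤ (Fintype.card F : ℝ) ^ (k + 1) * B.card + (B.card : ℝ) * B.card := by
          gcongr
          exact h4.2
      _ = _ := by field_simp; ring
  exact le_of_mul_le_mul_left h6 hq

/-- The additive energy of the lift of `A` to the paraboloid. -/
def paraboloidEnergy (A : Finset (Fin n → F)) : ℕ :=
  (((A ×ˢ A) ×ˢ (A ×ˢ A)).filter fun x => x.1.1 + x.1.2 = x.2.1 + x.2.2 ∧
    x.1.1 ⬝ᵥ x.1.1 + x.1.2 ⬝ᵥ x.1.2 = x.2.1 ⬝ᵥ x.2.1 + x.2.2 ⬝ᵥ x.2.2).card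

/-- Energy quadruples are rectangles with opposite corners `x, y`. Translate `x` to the origin and
split according to whether the side `z - x` is nonisotropic, the side `w - x` is, or neither; each
class is bounded by a pair count for every `x`. -/
lemma paraboloidEnergy_le (hχ : χ.IsPrimitive) (hF : ringChar F ≠ 2) {k : ℕ}
    (hn : n = 2 * k + 1) (A : Finset (Fin n → F)) :
    (paraboloidEnergy A : ℝ) ≤
      3 * ((A.card : ℝ) ^ 3 / Fintype.card F + (Fintype.card F : ℝ) ^ k * (A.card : ℝ) ^ 2) := by
  have h2 := two_ne_zero_of_ringChar hF
  set B : (Fin n → F) → Finset (Fin n → F) := fun x => A.image (· - x) with hB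
  have hBcard : ∀ x, (B x).card = A.card := fun x =>
    Finset.card_image_of_injective _ (sub_left_injective)
  have hmem : ∀ x, ∀ y ∈ A, y - x ∈ B x := fun x y hy => Finset.mem_image_of_mem _ hy
  set T1 := A.sigma fun x => (B x ×ˢ B x).filter fun p => p.1 ⬝ᵥ p.1 ≠ 0 ∧
    p.1 ⬝ᵥ p.2 = p.1 ⬝ᵥ p.1 with hT1
  set T2 := A.sigma fun x => (B x ×ˢ B x).filter fun p => p.1 ⬝ᵥ p.1 = 0 ∧ p.2 ⬝ᵥ p.2 = 0 ∧
    p.1 ⬝ᵥ p.2 = 0 with hT2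
  set Q := ((A ×ˢ A) ×ˢ (A ×ˢ A)).filter fun x => x.1.1 + x.1.2 = x.2.1 + x.2.2 ∧
    x.1.1 ⬝ᵥ x.1.1 + x.1.2 ⬝ᵥ x.1.2 = x.2.1 ⬝ᵥ x.2.1 + x.2.2 ⬝ᵥ x.2.2 with hQ
  have horth : ∀ x y z w : Fin n → F, x + y = z + w →
      x ⬝ᵥ x + y ⬝ᵥ y = z ⬝ᵥ z + w ⬝ᵥ w → (z - x) ⬝ᵥ (w - x) = 0 := by
    intro x y z w h1 h3
    have hy : y = z + w - x := eq_sub_of_add_eq' h1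
    subst hy
    have : 2 * ((z - x) ⬝ᵥ (w - x)) = 0 := by
      simp only [sub_dotProduct, dotProduct_sub, add_dotProduct, dotProduct_add,
        dotProduct_comm w z, dotProduct_comm x z, dotProduct_comm x w] at h3 ⊢
      linear_combination h3
    simpa [h2] using this
  have hy_sub : ∀ x y z w : Fin n → F, x + y = z + w → y - x = (z - x) + (w - x) := by
    intro x y z w h1
    rw [eq_sub_of_add_eq' h1]; abel
  set Q1 := Q.filter fun x => (x.2.1 - x.1.1) ⬝ᵥ (x.2.1 - x.1.1) ≠ 0
  set Q2 := Q.filter fun x => (x.2.2 - x.1.1) ⬝ᵥ (x.2.2 - x.1.1) ≠ 0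
  set Q3 := Q.filter fun x => (x.2.1 - x.1.1) ⬝ᵥ (x.2.1 - x.1.1) = 0 ∧
    (x.2.2 - x.1.1) ⬝ᵥ (x.2.2 - x.1.1) = 0
  have hQsub : Q ⊆ Q1 ∪ (Q2 ∪ Q3) := by
    intro x hx
    simp only [Q1, Q2, Q3, Finset.mem_union, Finset.mem_filter, hx, true_and]
    tauto
  have c1 : Q1.card ≤ T1.card := by
    refine Finset.card_le_card_of_injOn
      (fun x => ⟨x.1.1, (x.2.1 - x.1.1, x.1.2 - x.1.1)⟩) ?_ ?_
    · rintro ⟨⟨x, y⟩, ⟨z, w⟩⟩ hx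
      simp only [Q1, hQ, Finset.coe_filter, Finset.mem_filter, Finset.mem_product,
        Set.mem_ofPred_eq] at hx
      obtain ⟨⟨⟨⟨hx, hy⟩, hz, hw⟩, h1, h3⟩, h4⟩ := hx
      simp only [hT1, Finset.mem_coe, Finset.mem_sigma, Finset.mem_filter, Finset.mem_product]
      refine ⟨hx, ⟨hmem x z hz, hmem x y hy⟩, h4, ?_⟩
      -- The diagonal is the sum of two orthogonal sides, so it lies on the hyperplane attached to
      -- the first side.
      rw [hy_sub x y z w h1, dotProduct_add, horth x y z w h1 h3, add_zero]
    · rintro ⟨⟨x, y⟩, ⟨z, w⟩⟩ hx ⟨⟨x', y'⟩, ⟨z', w'⟩⟩ hx' h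
      simp only [Q1, hQ, Finset.coe_filter, Finset.mem_filter, Finset.mem_product,
        Set.mem_ofPred_eq] at hx hx'
      simp only [Sigma.mk.injEq, heq_eq_eq, Prod.mk.injEq] at h
      obtain ⟨rfl, h5, h6⟩ := h
      have hz := sub_left_injective h5
      have hy := sub_left_injective h6
      subst hz hy
      have := hx.1.2.1.symm.trans hx'.1.2.1
      simp only [Prod.mk.injEq, true_and]
      exact add_left_cancel this
  have c2 : Q2.card ≤ T1.card := by
    refine Finset.card_le_card_of_injOn
      (fun x => ⟨x.1.1, (x.2.2 - x.1.1, x.1.2 - x.1.1)⟩) ?_ ?_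
    · rintro ⟨⟨x, y⟩, ⟨z, w⟩⟩ hx
      simp only [Q2, hQ, Finset.coe_filter, Finset.mem_filter, Finset.mem_product,
        Set.mem_ofPred_eq] at hx
      obtain ⟨⟨⟨⟨hx, hy⟩, hz, hw⟩, h1, h3⟩, h4⟩ := hx
      simp only [hT1, Finset.mem_coe, Finset.mem_sigma, Finset.mem_filter, Finset.mem_product]
      refine ⟨hx, ⟨hmem x w hw, hmem x y hy⟩, h4, ?_⟩
      rw [hy_sub x y z w h1, dotProduct_add, dotProduct_comm _ (z - x), horth x y z w h1 h3,
        zero_add]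
    · rintro ⟨⟨x, y⟩, ⟨z, w⟩⟩ hx ⟨⟨x', y'⟩, ⟨z', w'⟩⟩ hx' h
      simp only [Q2, hQ, Finset.coe_filter, Finset.mem_filter, Finset.mem_product,
        Set.mem_ofPred_eq] at hx hx'
      simp only [Sigma.mk.injEq, heq_eq_eq, Prod.mk.injEq] at h
      obtain ⟨rfl, h5, h6⟩ := h
      have hw := sub_left_injective h5
      have hy := sub_left_injective h6
      subst hw hy
      have := hx.1.2.1.symm.trans hx'.1.2.1
      simp only [Prod.mk.injEq, true_and, and_true]
      exact add_right_cancel this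
  have c3 : Q3.card ≤ T2.card := by
    refine Finset.card_le_card_of_injOn
      (fun x => ⟨x.1.1, (x.2.1 - x.1.1, x.2.2 - x.1.1)⟩) ?_ ?_
    · rintro ⟨⟨x, y⟩, ⟨z, w⟩⟩ hx
      simp only [Q3, hQ, Finset.coe_filter, Finset.mem_filter, Finset.mem_product,
        Set.mem_ofPred_eq] at hx
      obtain ⟨⟨⟨⟨hx, hy⟩, hz, hw⟩, h1, h3⟩, h4, h5⟩ := hx
      simp only [hT2, Finset.mem_coe, Finset.mem_sigma, Finset.mem_filter, Finset.mem_product]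
      exact ⟨hx, ⟨hmem x z hz, hmem x w hw⟩, h4, h5, horth x y z w h1 h3⟩
    · rintro ⟨⟨x, y⟩, ⟨z, w⟩⟩ hx ⟨⟨x', y'⟩, ⟨z', w'⟩⟩ hx' h
      simp only [Q3, hQ, Finset.coe_filter, Finset.mem_filter, Finset.mem_product,
        Set.mem_ofPred_eq] at hx hx'
      simp only [Sigma.mk.injEq, heq_eq_eq, Prod.mk.injEq] at h
      obtain ⟨rfl, h5, h6⟩ := h
      have hz := sub_left_injective h5
      have hw := sub_left_injective h6
      subst hz hw
      have := hx.1.2.1.trans hx'.1.2.1.symm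
      simp only [Prod.mk.injEq, true_and, and_true]
      exact add_left_cancel this
  set b : ℝ := (A.card : ℝ) ^ 3 / Fintype.card F + (Fintype.card F : ℝ) ^ k * (A.card : ℝ) ^ 2
    with hb
  have hb' : b = A.card * ((A.card : ℝ) ^ 2 / Fintype.card F + (Fintype.card F : ℝ) ^ k * A.card) := by
    rw [hb]; ring
  have t1 : (T1.card : ℝ) ≤ b := by
    rw [hT1, Finset.card_sigma, Nat.cast_sum, hb', ← nsmul_eq_mul]
    refine Finset.sum_le_card_nsmul _ _ _ fun x _ => ?_
    have := card_nonisotropic_le hχ hn (B x)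
    rwa [hBcard] at this
  have t2 : (T2.card : ℝ) ≤ b := by
    rw [hT2, Finset.card_sigma, Nat.cast_sum, hb', ← nsmul_eq_mul]
    refine Finset.sum_le_card_nsmul _ _ _ fun x _ => ?_
    have := card_isotropic_le hχ hF hn (B x)
    rwa [hBcard] at this
  have hfinal : paraboloidEnergy A ≤ Q1.card + (Q2.card + Q3.card) := by
    refine (Finset.card_le_card hQsub).trans ((Finset.card_union_le _ _).trans ?_)
    gcongr
    exact Finset.card_union_le _ _
  have hfinal' : paraboloidEnergy A ≤ T1.card + (T1.card + T2.card) := by omega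
  have : (paraboloidEnergy A : ℝ) ≤ T1.card + (T1.card + T2.card) := by exact_mod_cast hfinal'
  linarith

end Energy

/-! ### Mass bounds on the paraboloid. -/

section Restriction

variable {F : Type*} [Field F] [Fintype F] [DecidableEq F] {n : ℕ} {χ : AddChar F ℂ}

/-- The horizontal slice of `E` at height `τ`. -/
def slice (E : Finset ((Fin n → F) × F)) (τ : F) : Finset (Fin n → F) :=
  Finset.univ.filter fun a => (a, τ) ∈ E

lemma mem_slice {E : Finset ((Fin n → F) × F)} {τ : F} {a : Fin n → F} :
    a ∈ slice E τ ↔ (a, τ) ∈ E := by simp [slice]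

lemma sum_eq_sum_slice {M : Type*} [AddCommMonoid M] (E : Finset ((Fin n → F) × F))
    (f : (Fin n → F) × F → M) :
    ∑ m ∈ E, f m = ∑ τ, ∑ a ∈ slice E τ, f (a, τ) := by
  simp only [slice, Finset.sum_filter]
  rw [Finset.sum_comm, ← Fintype.sum_prod_type', ← Finset.sum_filter]
  simp

lemma card_eq_sum_slice (E : Finset ((Fin n → F) × F)) :
    E.card = ∑ τ, (slice E τ).card := by
  simp only [Finset.card_eq_sum_ones]
  exact sum_eq_sum_slice E fun _ => 1

/-- The squared `L²` mass on the paraboloid of the Fourier transform of `g` restricted to `E`. -/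
noncomputable def paraboloidMass (χ : AddChar F ℂ) (E : Finset ((Fin n → F) × F))
    (g : (Fin n → F) × F → ℂ) : ℝ :=
  ∑ v : Fin n → F, ‖∑ m ∈ E, g m * χ (v ⬝ᵥ m.1 + (v ⬝ᵥ v) * m.2)‖ ^ 2

/-- Enlarge the sum over the paraboloid to the whole space and apply Plancherel. -/
lemma paraboloidMass_le_card (hχ : χ.IsPrimitive) (E : Finset ((Fin n → F) × F))
    (g : (Fin n → F) × F → ℂ) (hg : ∀ m ∈ E, ‖g m‖ ≤ 1) :
    paraboloidMass χ E g ≤ (Fintype.card F : ℝ) ^ (n + 1) * E.card := by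
  have h := sum_norm_sq_addChar_le hχ E g hg (fun m => m.1) (fun m => m.2)
  have hE : ((E ×ˢ E).filter fun x => x.1.1 = x.2.1 ∧ x.1.2 = x.2.2).card = E.card := by
    rw [← Finset.diag_card E]
    congr 1
    ext ⟨x, y⟩
    simp only [Finset.mem_filter, Finset.mem_product, Finset.mem_diag, ← Prod.ext_iff]
    constructor
    · rintro ⟨⟨h1, -⟩, h2⟩; exact ⟨h1, h2⟩
    · rintro ⟨h1, rfl⟩; exact ⟨⟨h1, h1⟩, rfl⟩
  rw [hE, Fintype.sum_prod_type] at h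
  refine le_trans (Finset.sum_le_sum fun v _ => ?_) h
  exact Finset.single_le_sum
    (f := fun σ => ‖∑ m ∈ E, g m * χ (v ⬝ᵥ m.1 + σ * m.2)‖ ^ 2)
    (fun _ _ => by positivity) (Finset.mem_univ (v ⬝ᵥ v))

/-- The contribution of one slice to the Fourier transform of the surface measure. -/
noncomputable def sliceKernel (χ : AddChar F ℂ) (E : Finset ((Fin n → F) × F))
    (g : (Fin n → F) × F → ℂ) (τ : F) (l : (Fin n → F) × F) : ℂ :=
  ∑ a ∈ slice E τ, g (a, τ) * χ (-(((a - l.1) ⬝ᵥ (a - l.1)) / (4 * (τ - l.2))))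

/-- In the expanded square, pairs at equal height contribute only on the diagonal. At different
heights the sum over `v` is a Gauss sum of modulus `q^(n/2)` times a quadratic phase. -/
lemma paraboloidMass_le_sum_sliceKernel (hχ : χ.IsPrimitive) (hF : ringChar F ≠ 2)
    (E : Finset ((Fin n → F) × F)) (g : (Fin n → F) × F → ℂ) (hg : ∀ m ∈ E, ‖g m‖ ≤ 1) :
    paraboloidMass χ E g ≤ (Fintype.card F : ℝ) ^ n * E.card +
      √(Fintype.card F) ^ n *
        ∑ τ, ∑ l ∈ E.filter (fun l => l.2 ≠ τ), ‖sliceKernel χ E g τ l‖ := by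
  have key : (paraboloidMass χ E g : ℂ) = ∑ l ∈ E, ∑ τ, (starRingEnd ℂ) (g l) *
      ∑ a ∈ slice E τ, g (a, τ) *
        ∑ v : Fin n → F, χ ((τ - l.2) * (v ⬝ᵥ v) + v ⬝ᵥ (a - l.1)) := by
    unfold paraboloidMass
    rw [Complex.ofReal_sum]
    simp only [norm_sq_sum_addChar]
    rw [Finset.sum_comm]
    simp only [Finset.sum_comm (s := Finset.univ (α := Fin n → F))]
    rw [Finset.sum_comm]
    refine Finset.sum_congr rfl fun l _ => ?_
    rw [sum_eq_sum_slice]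
    refine Finset.sum_congr rfl fun τ _ => ?_
    rw [Finset.mul_sum]
    refine Finset.sum_congr rfl fun a _ => ?_
    rw [Finset.mul_sum, Finset.mul_sum]
    refine Finset.sum_congr rfl fun v _ => ?_
    rw [dotProduct_sub, mul_comm (g _) ((starRingEnd ℂ) _), mul_assoc]
    congr 3
    ring
  have hnonneg : 0 ≤ paraboloidMass χ E g := Finset.sum_nonneg fun _ _ => by positivity
  have h1 := congrArg norm key
  rw [Complex.norm_real, Real.norm_of_nonneg hnonneg] at h1
  rw [h1]
  have hterm : ∀ l ∈ E, ∀ τ : F, ‖(starRingEnd ℂ) (g l) * ∑ a ∈ slice E τ, g (a, τ) *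
        ∑ v : Fin n → F, χ ((τ - l.2) * (v ⬝ᵥ v) + v ⬝ᵥ (a - l.1))‖ ≤
      (if l.2 = τ then (Fintype.card F : ℝ) ^ n else 0) +
        (if l.2 ≠ τ then √(Fintype.card F) ^ n * ‖sliceKernel χ E g τ l‖ else 0) := by
    intro l hl τ
    rw [norm_mul, RCLike.norm_conj]
    refine (mul_le_of_le_one_left (norm_nonneg _) (hg l hl)).trans ?_
    by_cases h : l.2 = τ
    · subst h
      simp only [sub_self, zero_mul, zero_add, sum_addChar_dot hχ, sub_eq_zero, mul_ite, mul_zero,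
        Finset.sum_ite_eq', if_true, ne_eq, not_true, if_false, add_zero, mem_slice, hl,
        Prod.mk.eta]
      rw [norm_mul, norm_pow, Complex.norm_natCast]
      exact mul_le_of_le_one_left (by positivity) (hg l hl)
    · have ht : τ - l.2 ≠ 0 := sub_ne_zero.2 (Ne.symm h)
      simp only [sum_addChar_quadratic hF ht, h, if_false, zero_add, ne_eq, not_false_iff, if_true]
      rw [← norm_quadGauss hχ hF ht, ← norm_pow, ← norm_mul, sliceKernel, Finset.mul_sum]
      refine le_of_eq (congrArg norm (Finset.sum_congr rfl fun a _ => ?_))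
      ring
  calc _ ≤ ∑ l ∈ E, ∑ τ, ((if l.2 = τ then (Fintype.card F : ℝ) ^ n else 0) +
        (if l.2 ≠ τ then √(Fintype.card F) ^ n * ‖sliceKernel χ E g τ l‖ else 0)) :=
        (norm_sum_le _ _).trans (Finset.sum_le_sum fun l hl =>
          (norm_sum_le _ _).trans (Finset.sum_le_sum fun τ _ => hterm l hl τ))
    _ = _ := by
      simp only [Finset.sum_add_distrib]
      congr 1
      · simp [mul_comm]
      · rw [Finset.sum_comm, Finset.mul_sum]
        refine Finset.sum_congr rfl fun τ _ => ?_
        rw [Finset.sum_filter, Finset.mul_sum]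
        refine Finset.sum_congr rfl fun l _ => ?_
        simp only [mul_ite, mul_zero]

lemma norm_sliceKernel_le (E : Finset ((Fin n → F) × F)) (g : (Fin n → F) × F → ℂ)
    (hg : ∀ m ∈ E, ‖g m‖ ≤ 1) (τ : F) (l : (Fin n → F) × F) :
    ‖sliceKernel χ E g τ l‖ ≤ (slice E τ).card := by
  refine (norm_sum_le _ _).trans ?_
  rw [← mul_one ((slice E τ).card : ℝ), ← nsmul_eq_mul]
  refine Finset.sum_le_card_nsmul _ _ _ fun a ha => ?_
  rw [norm_mul, AddChar.norm_apply, mul_one]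
  exact hg _ (mem_slice.1 ha)

lemma paraboloidMass_le_sq (hχ : χ.IsPrimitive) (hF : ringChar F ≠ 2)
    (E : Finset ((Fin n → F) × F)) (g : (Fin n → F) × F → ℂ) (hg : ∀ m ∈ E, ‖g m‖ ≤ 1) :
    paraboloidMass χ E g ≤ (Fintype.card F : ℝ) ^ n * E.card +
      √(Fintype.card F) ^ n * (E.card : ℝ) ^ 2 := by
  refine (paraboloidMass_le_sum_sliceKernel hχ hF E g hg).trans ?_
  gcongr
  calc _ ≤ ∑ τ, (E.card : ℝ) * (slice E τ).card := by
        refine Finset.sum_le_sum fun τ _ => ?_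
        refine (Finset.sum_le_card_nsmul _ _ _ fun l _ => norm_sliceKernel_le E g hg τ l).trans ?_
        rw [nsmul_eq_mul]
        gcongr
        exact Finset.filter_subset _ _
    _ = _ := by
        rw [← Finset.mul_sum, sq]
        congr 1
        exact_mod_cast (card_eq_sum_slice E).symm

lemma sum_norm_pow_four_le (hχ : χ.IsPrimitive) (A : Finset (Fin n → F)) (c : (Fin n → F) → ℂ)
    (hc : ∀ a ∈ A, ‖c a‖ ≤ 1) :
    ∑ p : (Fin n → F) × F, ‖∑ a ∈ A, c a * χ (p.1 ⬝ᵥ a + p.2 * (a ⬝ᵥ a))‖ ^ 4 ≤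
      (Fintype.card F : ℝ) ^ (n + 1) * paraboloidEnergy A := by
  have h := sum_norm_sq_addChar_le hχ (A ×ˢ A) (fun x => c x.1 * c x.2)
    (fun x hx => by
      have hx := Finset.mem_product.1 hx
      rw [norm_mul]
      exact mul_le_one₀ (hc _ hx.1) (norm_nonneg _) (hc _ hx.2))
    (fun x => x.1 + x.2) (fun x => x.1 ⬝ᵥ x.1 + x.2 ⬝ᵥ x.2)
  refine le_trans (le_of_eq (Finset.sum_congr rfl fun p _ => ?_)) h
  rw [show 4 = 2 * 2 from rfl, pow_mul, ← norm_pow, sq (∑ a ∈ A, _), Finset.sum_mul_sum,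
    Finset.sum_product]
  congr 2
  refine Finset.sum_congr rfl fun a _ => Finset.sum_congr rfl fun b _ => ?_
  rw [mul_mul_mul_comm, ← AddChar.map_add_eq_mul, dotProduct_add]
  congr 2
  ring

/-- Expanding the quadratic phase turns the kernel, up to a unimodular factor, into the transform of
the lifted slice at a frequency `φ l`. Since `φ` is injective, the sum is at most the full fourth
moment. -/
lemma sum_norm_sliceKernel_pow_four_le (hχ : χ.IsPrimitive) (hF : ringChar F ≠ 2)
    (E : Finset ((Fin n → F) × F)) (g : (Fin n → F) × F → ℂ) (hg : ∀ m ∈ E, ‖g m‖ ≤ 1) (τ : F) :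
    ∑ l ∈ E.filter (fun l => l.2 ≠ τ), ‖sliceKernel χ E g τ l‖ ^ 4 ≤
      (Fintype.card F : ℝ) ^ (n + 1) * paraboloidEnergy (slice E τ) := by
  have h2 := two_ne_zero_of_ringChar hF
  have h4 : (4 : F) ≠ 0 := by
    have : (4 : F) = 2 * 2 := by norm_num
    rw [this]; exact mul_ne_zero h2 h2
  refine le_trans ?_ (sum_norm_pow_four_le hχ (slice E τ) (fun a => g (a, τ))
    (fun a ha => hg _ (mem_slice.1 ha)))
  set f : (Fin n → F) × F → ℝ := fun p =>
    ‖∑ a ∈ slice E τ, g (a, τ) * χ (p.1 ⬝ᵥ a + p.2 * (a ⬝ᵥ a))‖ ^ 4 with hf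
  set φ : (Fin n → F) × F → (Fin n → F) × F := fun l =>
    ((2 / (4 * (τ - l.2))) • l.1, -(1 / (4 * (τ - l.2)))) with hφ
  have hinj : Set.InjOn φ (E.filter (fun l => l.2 ≠ τ)) := by
    rintro ⟨a, s⟩ hs ⟨b, t⟩ ht hst
    have hs' : τ - s ≠ 0 := sub_ne_zero.2 (Ne.symm (Finset.mem_filter.1 hs).2)
    have ht' : τ - t ≠ 0 := sub_ne_zero.2 (Ne.symm (Finset.mem_filter.1 ht).2)
    simp only [hφ, Prod.mk.injEq, neg_inj] at hst
    have e1 : s = t := by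
      have := hst.2
      rw [div_eq_div_iff (mul_ne_zero h4 hs') (mul_ne_zero h4 ht'), one_mul, one_mul] at this
      have := mul_left_cancel₀ h4 this
      exact (sub_right_injective this).symm
    subst e1
    have := smul_right_injective (Fin n → F) (r := 2 / (4 * (τ - s)))
      (div_ne_zero h2 (mul_ne_zero h4 hs')) hst.1
    rw [this]
  have hval : ∀ l ∈ E.filter (fun l => l.2 ≠ τ), ‖sliceKernel χ E g τ l‖ ^ 4 = f (φ l) := by
    intro l hl
    have hl' : τ - l.2 ≠ 0 := sub_ne_zero.2 (Ne.symm (Finset.mem_filter.1 hl).2)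
    simp only [hf, hφ, sliceKernel]
    congr 1
    have : ∑ a ∈ slice E τ, g (a, τ) * χ (-(((a - l.1) ⬝ᵥ (a - l.1)) / (4 * (τ - l.2)))) =
        χ (-((l.1 ⬝ᵥ l.1) / (4 * (τ - l.2)))) * ∑ a ∈ slice E τ, g (a, τ) *
          χ (((2 / (4 * (τ - l.2))) • l.1) ⬝ᵥ a + -(1 / (4 * (τ - l.2))) * (a ⬝ᵥ a)) := by
      rw [Finset.mul_sum]
      refine Finset.sum_congr rfl fun a _ => ?_
      rw [mul_left_comm, ← AddChar.map_add_eq_mul]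
      congr 2
      simp only [sub_dotProduct, dotProduct_sub, smul_dotProduct, smul_eq_mul,
        dotProduct_comm a l.1]
      ring
    rw [this, norm_mul, AddChar.norm_apply, one_mul]
  rw [Finset.sum_congr rfl hval, ← Finset.sum_image (f := f) hinj]
  exact Finset.sum_le_sum_of_subset_of_nonneg (Finset.subset_univ _) fun _ _ _ => by
    simp only [hf]; positivity

/-- Power mean inequality over the `q` heights. -/
lemma sum_rpow_slice_card_le (E : Finset ((Fin n → F) × F)) {α : ℝ} (h0 : 0 < α) (h1 : α ≤ 1) :
    ∑ τ, ((slice E τ).card : ℝ) ^ α ≤ (Fintype.card F : ℝ) ^ (1 - α) * (E.card : ℝ) ^ α := by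
  have h := Real.rpow_sum_le_const_mul_sum_rpow_of_nonneg (Finset.univ : Finset F)
    (f := fun τ => ((slice E τ).card : ℝ) ^ α) (p := α⁻¹) ((one_le_inv₀ h0).2 h1)
    (fun _ _ => by positivity)
  have hs : ∑ τ, (((slice E τ).card : ℝ) ^ α) ^ α⁻¹ = E.card := by
    rw [card_eq_sum_slice E, Nat.cast_sum]
    exact Finset.sum_congr rfl fun τ _ => Real.rpow_rpow_inv (by positivity) h0.ne'
  rw [hs, Finset.card_univ] at h
  have hS : 0 ≤ ∑ τ, ((slice E τ).card : ℝ) ^ α := Finset.sum_nonneg fun _ _ => by positivity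
  calc _ = ((∑ τ, ((slice E τ).card : ℝ) ^ α) ^ α⁻¹) ^ α :=
        (Real.rpow_inv_rpow hS h0.ne').symm
    _ ≤ ((Fintype.card F : ℝ) ^ (α⁻¹ - 1) * E.card) ^ α := by gcongr
    _ = _ := by
        rw [Real.mul_rpow (by positivity) (by positivity), ← Real.rpow_mul (by positivity)]
        congr 2
        field_simp

lemma paraboloidMass_le_of_energy (hχ : χ.IsPrimitive) (hF : ringChar F ≠ 2) {k : ℕ}
    (hn : n = 2 * k + 1) (E : Finset ((Fin n → F) × F)) (g : (Fin n → F) × F → ℂ)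
    (hg : ∀ m ∈ E, ‖g m‖ ≤ 1) :
    paraboloidMass χ E g ≤ (Fintype.card F : ℝ) ^ n * (E.card +
      3 * ((Fintype.card F : ℝ) ^ (-(k : ℝ) / 2) * (E.card : ℝ) ^ (3 / 2 : ℝ) +
        (Fintype.card F : ℝ) ^ (1 / 2 - (k : ℝ) / 4) * (E.card : ℝ) ^ (5 / 4 : ℝ))) := by
  have hq : (0 : ℝ) < Fintype.card F := card_field_pos
  refine (paraboloidMass_le_sum_sliceKernel hχ hF E g hg).trans ?_
  set q : ℝ := (Fintype.card F : ℝ) with hqdef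
  set N : ℝ := (E.card : ℝ) with hN
  have hN0 : 0 ≤ N := Nat.cast_nonneg _
  rw [mul_add]
  refine add_le_add le_rfl ?_
  have hslice : ∀ τ : F, ∑ l ∈ E.filter (fun l => l.2 ≠ τ), ‖sliceKernel χ E g τ l‖ ≤
      3 * (N ^ (3 / 4 : ℝ) * q ^ ((k + 1) / 2 : ℝ)) *
        (q ^ (-1 / 4 : ℝ) * ((slice E τ).card : ℝ) ^ (3 / 4 : ℝ) +
          q ^ (k / 4 : ℝ) * ((slice E τ).card : ℝ) ^ (1 / 2 : ℝ)) := by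
    intro τ
    set X := ∑ l ∈ E.filter (fun l => l.2 ≠ τ), ‖sliceKernel χ E g τ l‖ with hX
    set a : ℝ := ((slice E τ).card : ℝ) with ha
    have ha0 : 0 ≤ a := Nat.cast_nonneg _
    have hX0 : 0 ≤ X := Finset.sum_nonneg fun _ _ => norm_nonneg _
    -- Hölder from `ℓ¹` to `ℓ⁴` over `E`, then the energy bound for the slice.
    have hX4 : X ^ 4 ≤ N ^ 3 * (q ^ (n + 1) * (3 * (a ^ 3 / q + q ^ k * a ^ 2))) := by
      have hcard : ((E.filter fun l => l.2 ≠ τ).card : ℝ) ≤ N := by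
        rw [hN]; exact_mod_cast Finset.card_filter_le _ _
      have hen := paraboloidEnergy_le hχ hF hn (slice E τ)
      rw [← hqdef, ← ha] at hen
      calc X ^ 4 ≤ ((E.filter fun l => l.2 ≠ τ).card : ℝ) ^ 3 *
            ∑ l ∈ E.filter (fun l => l.2 ≠ τ), ‖sliceKernel χ E g τ l‖ ^ 4 :=
            pow_sum_le_card_mul_sum_pow (fun _ _ => norm_nonneg _) 3
        _ ≤ N ^ 3 * (q ^ (n + 1) * paraboloidEnergy (slice E τ)) := by
            gcongr
            exact sum_norm_sliceKernel_pow_four_le hχ hF E g hg τ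
        _ ≤ _ := by gcongr
    refine le_of_pow_le_pow_left₀ (n := 4) (by norm_num) (by positivity) (hX4.trans ?_)
    have p1 : (N ^ (3 / 4 : ℝ)) ^ 4 = N ^ 3 := by
      rw [← Real.rpow_mul_natCast hN0, ← Real.rpow_natCast N 3]; norm_num
    have p2 : (q ^ ((k + 1) / 2 : ℝ)) ^ 4 = q ^ (n + 1) := by
      rw [← Real.rpow_mul_natCast hq.le, ← Real.rpow_natCast q (n + 1), hn]
      congr 1; push_cast; ring
    have p3 : (q ^ (-1 / 4 : ℝ) * a ^ (3 / 4 : ℝ)) ^ 4 = a ^ 3 / q := by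
      rw [mul_pow, ← Real.rpow_mul_natCast hq.le, ← Real.rpow_mul_natCast ha0,
        ← Real.rpow_natCast a 3, div_eq_mul_inv (a ^ _) q, ← Real.rpow_neg_one, mul_comm]
      norm_num
    have p4 : (q ^ (k / 4 : ℝ) * a ^ (1 / 2 : ℝ)) ^ 4 = q ^ k * a ^ 2 := by
      rw [mul_pow, ← Real.rpow_mul_natCast hq.le, ← Real.rpow_mul_natCast ha0,
        ← Real.rpow_natCast a 2, ← Real.rpow_natCast q k]
      norm_num
    have hu : 0 ≤ q ^ (-1 / 4 : ℝ) * a ^ (3 / 4 : ℝ) := by positivity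
    have hw : 0 ≤ q ^ (k / 4 : ℝ) * a ^ (1 / 2 : ℝ) := by positivity
    rw [mul_pow, mul_pow 3, mul_pow (N ^ (3 / 4 : ℝ)), p1, p2, ← p3, ← p4]
    generalize q ^ (-1 / 4 : ℝ) * a ^ (3 / 4 : ℝ) = u at hu
    generalize q ^ (k / 4 : ℝ) * a ^ (1 / 2 : ℝ) = w at hw
    have huw : u ^ 4 + w ^ 4 ≤ (u + w) ^ 4 := pow_add_pow_le hu hw (by norm_num)
    calc N ^ 3 * (q ^ (n + 1) * (3 * (u ^ 4 + w ^ 4)))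
        = 3 * (N ^ 3 * q ^ (n + 1)) * (u ^ 4 + w ^ 4) := by ring
      _ ≤ 3 ^ 4 * (N ^ 3 * q ^ (n + 1)) * (u + w) ^ 4 := by
          gcongr
          norm_num
  calc √q ^ n * ∑ τ, ∑ l ∈ E.filter (fun l => l.2 ≠ τ), ‖sliceKernel χ E g τ l‖
      ≤ √q ^ n * ∑ τ, 3 * (N ^ (3 / 4 : ℝ) * q ^ ((k + 1) / 2 : ℝ)) *
        (q ^ (-1 / 4 : ℝ) * ((slice E τ).card : ℝ) ^ (3 / 4 : ℝ) +
          q ^ (k / 4 : ℝ) * ((slice E τ).card : ℝ) ^ (1 / 2 : ℝ)) := by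
        gcongr with τ
        exact hslice τ
    _ = √q ^ n * (3 * (N ^ (3 / 4 : ℝ) * q ^ ((k + 1) / 2 : ℝ)) *
        (q ^ (-1 / 4 : ℝ) * ∑ τ, ((slice E τ).card : ℝ) ^ (3 / 4 : ℝ) +
          q ^ (k / 4 : ℝ) * ∑ τ, ((slice E τ).card : ℝ) ^ (1 / 2 : ℝ))) := by
        rw [← Finset.mul_sum, Finset.sum_add_distrib, Finset.mul_sum, Finset.mul_sum]
    _ ≤ √q ^ n * (3 * (N ^ (3 / 4 : ℝ) * q ^ ((k + 1) / 2 : ℝ)) *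
        (q ^ (-1 / 4 : ℝ) * (q ^ (1 - 3 / 4 : ℝ) * N ^ (3 / 4 : ℝ)) +
          q ^ (k / 4 : ℝ) * (q ^ (1 - 1 / 2 : ℝ) * N ^ (1 / 2 : ℝ)))) := by
        gcongr
        · exact sum_rpow_slice_card_le E (by norm_num) (by norm_num)
        · exact sum_rpow_slice_card_le E (by norm_num) (by norm_num)
    _ = _ := by
        have s1 : √q ^ n * q ^ ((k + 1) / 2 : ℝ) = q ^ n * q ^ (-(k : ℝ) / 2) := by
          rw [Real.sqrt_eq_rpow, ← Real.rpow_mul_natCast hq.le, ← Real.rpow_natCast q n,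
            ← Real.rpow_add hq, ← Real.rpow_add hq, hn]
          congr 1; push_cast; ring
        have s2 : q ^ (-1 / 4 : ℝ) * q ^ (1 - 3 / 4 : ℝ) = 1 := by
          rw [← Real.rpow_add hq]; norm_num
        have s3 : q ^ (-(k : ℝ) / 2) * (q ^ (k / 4 : ℝ) * q ^ (1 - 1 / 2 : ℝ)) =
            q ^ (1 / 2 - (k : ℝ) / 4) := by
          rw [← Real.rpow_add hq, ← Real.rpow_add hq]
          congr 1; ring
        have s4 : N ^ (3 / 4 : ℝ) * N ^ (3 / 4 : ℝ) = N ^ (3 / 2 : ℝ) := by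
          rw [← Real.rpow_add_of_nonneg hN0 (by norm_num) (by norm_num)]; norm_num
        have s5 : N ^ (3 / 4 : ℝ) * N ^ (1 / 2 : ℝ) = N ^ (5 / 4 : ℝ) := by
          rw [← Real.rpow_add_of_nonneg hN0 (by norm_num) (by norm_num)]; norm_num
        rw [← s3, ← s4, ← s5]
        linear_combination (3 * N ^ (3 / 4 : ℝ) * (q ^ (-1 / 4 : ℝ) * (q ^ (1 - 3 / 4 : ℝ) *
          N ^ (3 / 4 : ℝ)) + q ^ (k / 4 : ℝ) * (q ^ (1 - 1 / 2 : ℝ) * N ^ (1 / 2 : ℝ)))) * s1 +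
          (3 * q ^ n * q ^ (-(k : ℝ) / 2) * N ^ (3 / 4 : ℝ) * N ^ (3 / 4 : ℝ)) * s2

end Restriction

/-! ### Comparing powers, and passing from restricted type to `ℓ^r`. -/

lemma rpow_mul_rpow_le_rpow {q N a b θ : ℝ} (hq : 0 < q) (hN : 0 < N)
    (h : a * Real.log q + b * Real.log N ≤ θ * Real.log N) : q ^ a * N ^ b ≤ N ^ θ := by
  rw [Real.rpow_def_of_pos hq, Real.rpow_def_of_pos hN, Real.rpow_def_of_pos hN, ← Real.exp_add]
  apply Real.exp_le_exp.2
  linarith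

/-- A restricted-type bound with exponent `1 - β` gives an `ℓ^r` bound with a logarithmic loss
for all `r ≥ 1 / β`. -/
lemma sum_rpow_le_harmonic {α : Type*} [DecidableEq α] (G : α → ℝ) (hG : ∀ x, 0 ≤ G x)
    {M β r : ℝ} (hM : 0 ≤ M) (hr : 0 < r) (hβ : 1 ≤ r * β)
    (h : ∀ E : Finset α, ∑ x ∈ E, G x ≤ M * (E.card : ℝ) ^ (1 - β)) (E : Finset α) :
    ∑ x ∈ E, G x ^ r ≤ M ^ r * (harmonic E.card : ℝ) := by
  induction hN : E.card generalizing E with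
  | zero => rw [Finset.card_eq_zero] at hN; subst hN; simp
  | succ N ih =>
    have hne : E.Nonempty := Finset.card_pos.1 (by omega)
    -- The smallest of the values on `E` is at most their average, hence at most `M |E|^(-β)`; its
    -- `r`-th power is the last term of the harmonic sum.
    obtain ⟨m, hm, hmin⟩ := Finset.exists_min_image E G hne
    have hN0 : (0 : ℝ) < (N + 1 : ℕ) := by positivity
    have h1 : G m ≤ M * ((N + 1 : ℕ) : ℝ) ^ (-β) := by
      have h2 : ((N + 1 : ℕ) : ℝ) * G m ≤ M * ((N + 1 : ℕ) : ℝ) ^ (1 - β) := by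
        have := h E
        rw [hN] at this
        refine le_trans ?_ this
        rw [← hN, ← nsmul_eq_mul]
        exact Finset.card_nsmul_le_sum _ _ _ hmin
      rw [sub_eq_add_neg, Real.rpow_add hN0, Real.rpow_one, mul_left_comm] at h2
      exact le_of_mul_le_mul_left h2 hN0
    have h3 : G m ^ r ≤ M ^ r * ((N + 1 : ℕ) : ℝ)⁻¹ := by
      calc G m ^ r ≤ (M * ((N + 1 : ℕ) : ℝ) ^ (-β)) ^ r := Real.rpow_le_rpow (hG m) h1 hr.le
        _ = M ^ r * ((N + 1 : ℕ) : ℝ) ^ (-β * r) := by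
            rw [Real.mul_rpow hM (by positivity), ← Real.rpow_mul hN0.le]
        _ ≤ M ^ r * ((N + 1 : ℕ) : ℝ) ^ (-1 : ℝ) := by
            gcongr
            · exact_mod_cast Nat.succ_le_succ (Nat.zero_le N)
            · linarith
        _ = _ := by rw [Real.rpow_neg_one]
    have h4 := ih (E.erase m) (by rw [Finset.card_erase_of_mem hm, hN]; rfl)
    rw [← Finset.add_sum_erase E _ hm, harmonic_succ]
    push_cast at h3 ⊢
    linarith

/-! ### The combined mass bound, duality and the `ℓ^r` estimate. -/

section Extension

variable {F : Type*} [Field F] [Fintype F] [DecidableEq F] {n : ℕ} {χ : AddChar F ℂ}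

/-- In the logarithms `x` of `N` and `y` of `q`, every comparison is linear. The switch point is
where `qN = N^θ`: above it Plancherel suffices, below it the energy bound does, except for small `N`
when `k = 1`. The constant is `7 = 1 + 3 · 2`. -/
lemma paraboloidMass_le (hχ : χ.IsPrimitive) (hF : ringChar F ≠ 2) {k : ℕ} (hk : 1 ≤ k)
    (hn : n = 2 * k + 1) (E : Finset ((Fin n → F) × F)) (g : (Fin n → F) × F → ℂ)
    (hg : ∀ m ∈ E, ‖g m‖ ≤ 1) :
    paraboloidMass χ E g ≤ (Fintype.card F : ℝ) ^ n *
      (7 * (E.card : ℝ) ^ (1 + 2 * (2 * k + 1) / (2 * k + 2 : ℝ) ^ 2)) := by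
  rcases E.eq_empty_or_nonempty with rfl | hE
  · simp only [paraboloidMass, Finset.sum_empty, norm_zero]
    simp only [ne_eq, OfNat.ofNat_ne_zero, not_false_eq_true, zero_pow, Finset.sum_const_zero]
    positivity
  have hq : (0 : ℝ) < Fintype.card F := card_field_pos
  have hy : 0 ≤ Real.log (Fintype.card F) := Real.log_nonneg one_le_card_field
  have hN1 : (1 : ℝ) ≤ E.card := by exact_mod_cast hE.card_pos
  have hN : (0 : ℝ) < E.card := by linarith
  have hx : 0 ≤ Real.log E.card := Real.log_nonneg hN1
  have hc := paraboloidMass_le_card hχ E g hg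
  have hb := paraboloidMass_le_of_energy hχ hF hn E g hg
  have ha := paraboloidMass_le_sq hχ hF E g hg
  set q : ℝ := (Fintype.card F : ℝ) with hqdef
  set N : ℝ := (E.card : ℝ)
  set x := Real.log N
  set y := Real.log q
  set κ : ℝ := (k : ℝ) with hκ
  have hκ1 : 1 ≤ κ := by rw [hκ]; exact_mod_cast hk
  set θ : ℝ := 1 + 2 * (2 * κ + 1) / (2 * κ + 2) ^ 2 with hθ
  have hθ1 : 1 ≤ θ := by
    have : 0 ≤ 2 * (2 * κ + 1) / (2 * κ + 2) ^ 2 := by positivity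
    linarith
  have hNθ : N ≤ N ^ θ := by
    conv_lhs => rw [← Real.rpow_one N]
    exact Real.rpow_le_rpow_of_exponent_le hN1 hθ1
  have hNθ0 : 0 ≤ N ^ θ := by positivity
  have hθx : θ * x = x + 2 * (2 * κ + 1) * x / (2 * κ + 2) ^ 2 := by rw [hθ]; ring
  have hD : 0 < (2 * κ + 2) ^ 2 := by positivity
  by_cases hlarge : (2 * κ + 2) ^ 2 * y ≤ 2 * (2 * κ + 1) * x
  · have : q ^ (1 : ℝ) * N ^ (1 : ℝ) ≤ N ^ θ := by
      apply rpow_mul_rpow_le_rpow hq hN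
      have : y ≤ 2 * (2 * κ + 1) * x / (2 * κ + 2) ^ 2 := by
        rw [le_div_iff₀ hD]; linarith
      change 1 * y + 1 * x ≤ θ * x
      rw [hθx]; linarith
    rw [Real.rpow_one, Real.rpow_one] at this
    refine hc.trans ?_
    rw [pow_succ, mul_assoc]
    exact mul_le_mul_of_nonneg_left (by linarith) (by positivity)
  push Not at hlarge
  have hA : q ^ (-κ / 2) * N ^ (3 / 2 : ℝ) ≤ N ^ θ := by
    apply rpow_mul_rpow_le_rpow hq hN
    change -κ / 2 * y + 3 / 2 * x ≤ θ * x
    rw [hθx, ← sub_le_iff_le_add', le_div_iff₀ hD]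
    have : κ * (2 * κ * x) ≤ κ * ((2 * κ + 2) ^ 2 * y / 2) := by
      gcongr
      linarith
    linarith
  -- For `k = 1` the term `q^(1/4) N^(5/4)` is within `N^θ` only when `N ≥ q²`; the quadratic Gauss
  -- sum bound covers smaller `N`.
  by_cases hsmall : k = 1 ∧ x < 2 * y
  · obtain ⟨hk1, hxy⟩ := hsmall
    have hκ' : κ = 1 := by rw [hκ, hk1]; norm_num
    have : q ^ (-3 / 2 : ℝ) * N ^ (2 : ℝ) ≤ N ^ θ := by
      apply rpow_mul_rpow_le_rpow hq hN
      change -3 / 2 * y + 2 * x ≤ θ * x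
      rw [hθx, hκ']
      linarith
    refine ha.trans ?_
    have e : √q ^ n * N ^ 2 = q ^ n * (q ^ (-3 / 2 : ℝ) * N ^ (2 : ℝ)) := by
      rw [Real.sqrt_eq_rpow, ← Real.rpow_mul_natCast hq.le, ← mul_assoc, ← Real.rpow_natCast q n,
        ← Real.rpow_add hq, hn, hk1, Real.rpow_two]
      norm_num
    rw [e, ← mul_add]
    gcongr
    linarith
  · have hB : q ^ (1 / 2 - κ / 4) * N ^ (5 / 4 : ℝ) ≤ N ^ θ := by
      apply rpow_mul_rpow_le_rpow hq hN
      change (1 / 2 - κ / 4) * y + 5 / 4 * x ≤ θ * x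
      rw [hθx, ← sub_le_iff_le_add', le_div_iff₀ hD]
      rcases Nat.lt_or_ge 1 k with hk2 | hk2
      · have hκ2 : 2 ≤ κ := by rw [hκ]; exact_mod_cast hk2
        have h1 : (κ - 2) * (2 * (2 * κ + 1) * x) ≤ (κ - 2) * ((2 * κ + 2) ^ 2 * y) :=
          mul_le_mul_of_nonneg_left hlarge.le (by linarith)
        have h2 : 0 ≤ κ * x := by positivity
        linarith
      · have hk1 : k = 1 := le_antisymm hk2 hk
        have hκ' : κ = 1 := by rw [hκ, hk1]; norm_num
        have : 2 * y ≤ x := by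
          by_contra hcon
          exact hsmall ⟨hk1, not_le.1 hcon⟩
        rw [hκ']
        linarith
    refine hb.trans ?_
    gcongr
    linarith

/-- Splitting off the last coordinate. -/
def lastEquiv (F : Type*) (n : ℕ) : (Fin (n + 1) → F) ≃ (Fin n → F) × F where
  toFun m := (Fin.init m, m (Fin.last n))
  invFun p := Fin.snoc (α := fun _ => F) p.1 p.2
  left_inv m := Fin.snoc_init_self m
  right_inv p := by simp

/-- The parametrization of the paraboloid as a graph. -/
def paraboloidEquiv (F : Type*) [Field F] [Fintype F] [DecidableEq F] (n : ℕ) :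
    (Fin n → F) ≃ paraboloid F (n + 1) where
  toFun v := ⟨(lastEquiv F n).symm (v, v ⬝ᵥ v), by
    simp [paraboloid, lastEquiv, dotProduct, sq]⟩
  invFun x := (lastEquiv F n x.1).1
  left_inv v := by simp
  right_inv x := by
    have hx := x.2
    simp only [paraboloid, Finset.mem_filter, Finset.mem_univ, true_and] at hx
    apply Subtype.ext
    rw [Equiv.symm_apply_eq]
    refine Prod.ext rfl ?_
    simp [lastEquiv, dotProduct, hx, Fin.init, sq]

lemma dotProduct_lastEquiv (p : (Fin n → F) × F) (m : Fin (n + 1) → F) :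
    (lastEquiv F n).symm p ⬝ᵥ m = p.1 ⬝ᵥ (lastEquiv F n m).1 + p.2 * (lastEquiv F n m).2 := by
  simp [lastEquiv, dotProduct, Fin.sum_univ_castSucc, Fin.init]

lemma card_paraboloid : (paraboloid F (n + 1)).card = Fintype.card F ^ n := by
  rw [← Fintype.card_coe, ← Fintype.card_congr (paraboloidEquiv F n)]
  simp

lemma sum_norm_sq_paraboloid_eq (E : Finset (Fin (n + 1) → F)) (g : (Fin (n + 1) → F) → ℂ) :
    ∑ x : paraboloid F (n + 1), ‖∑ m ∈ E, g m * χ ((x : Fin (n + 1) → F) ⬝ᵥ m)‖ ^ 2 =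
      paraboloidMass χ (E.map (lastEquiv F n).toEmbedding)
        (fun p => g ((lastEquiv F n).symm p)) := by
  rw [← Equiv.sum_comp (paraboloidEquiv F n)]
  simp only [paraboloidMass, Finset.sum_map, Equiv.coe_toEmbedding, Equiv.symm_apply_apply]
  refine Finset.sum_congr rfl fun v _ => ?_
  simp only [paraboloidEquiv, Equiv.coe_fn_mk, dotProduct_lastEquiv]

lemma lpAvg_two {α : Type*} [Fintype α] (f : α → ℂ) :
    lpAvg 2 f = √((Fintype.card α : ℝ)⁻¹ * ∑ x, ‖f x‖ ^ 2) := by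
  simp [lpAvg, Real.sqrt_eq_rpow]

/-- Unimodular weights `u` remove the absolute values; swapping the sums pairs `f` with the
transform of `u` on `E`. Cauchy–Schwarz and the mass bound finish, with `√7 ≤ 3`. -/
lemma sum_norm_extension_le (hχ : χ.IsPrimitive) (hF : ringChar F ≠ 2) {k : ℕ} (hk : 1 ≤ k)
    (hn : n = 2 * k + 1) (f : paraboloid F (n + 1) → ℂ) (E : Finset (Fin (n + 1) → F)) :
    ∑ m ∈ E, ‖extension χ (paraboloid F (n + 1)) f m‖ ≤
      3 * lpAvg 2 f * (E.card : ℝ) ^ ((1 + 2 * (2 * k + 1) / (2 * k + 2 : ℝ) ^ 2) / 2) := by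
  have hq : (0 : ℝ) < Fintype.card F := card_field_pos
  choose u hu1 hu2 using fun m =>
    Complex.exists_norm_eq_mul_self (extension χ (paraboloid F (n + 1)) f m)
  set Y : paraboloid F (n + 1) → ℂ := fun x =>
    ∑ m ∈ E, u m * χ ((x : Fin (n + 1) → F) ⬝ᵥ m) with hY
  set θ : ℝ := 1 + 2 * (2 * k + 1) / (2 * k + 2 : ℝ) ^ 2 with hθ
  have hmass : ∑ x, ‖Y x‖ ^ 2 ≤ (Fintype.card F : ℝ) ^ n * (7 * (E.card : ℝ) ^ θ) := by
    rw [sum_norm_sq_paraboloid_eq]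
    have := paraboloidMass_le hχ hF hk hn (E.map (lastEquiv F n).toEmbedding)
      (fun p => u ((lastEquiv F n).symm p)) (fun m _ => (hu1 _).le)
    rwa [Finset.card_map] at this
  have hdual : ((∑ m ∈ E, ‖extension χ (paraboloid F (n + 1)) f m‖ : ℝ) : ℂ) =
      ((paraboloid F (n + 1)).card : ℂ)⁻¹ * ∑ x, f x * Y x := by
    rw [Complex.ofReal_sum]
    simp only [hu2]
    simp only [extension, hY, Finset.mul_sum]
    rw [Finset.sum_comm]
    refine Finset.sum_congr rfl fun x _ => Finset.sum_congr rfl fun m _ => ?_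
    ring
  have hcard : ((paraboloid F (n + 1)).card : ℝ) = (Fintype.card F : ℝ) ^ n := by
    rw [card_paraboloid]; push_cast; rfl
  have h1 := congrArg norm hdual
  rw [Complex.norm_real, Real.norm_of_nonneg (Finset.sum_nonneg fun _ _ => norm_nonneg _),
    norm_mul, norm_inv, Complex.norm_natCast, hcard] at h1
  rw [h1, lpAvg_two, Fintype.card_coe, hcard]
  have hqn : 0 < (Fintype.card F : ℝ) ^ n := by positivity
  set Q : ℝ := (Fintype.card F : ℝ) ^ n
  have hNθ : √((E.card : ℝ) ^ θ) = (E.card : ℝ) ^ (θ / 2) := by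
    rw [Real.sqrt_eq_rpow, ← Real.rpow_mul (by positivity)]
    congr 1
    ring
  calc Q⁻¹ * ‖∑ x, f x * Y x‖ ≤ Q⁻¹ * (√(∑ x, ‖f x‖ ^ 2) * √(∑ x, ‖Y x‖ ^ 2)) := by
        gcongr
        refine (norm_sum_le _ _).trans ?_
        simp only [norm_mul]
        exact Real.sum_mul_le_sqrt_mul_sqrt _ _ _
    _ ≤ Q⁻¹ * (√(∑ x, ‖f x‖ ^ 2) * √(Q * (7 * (E.card : ℝ) ^ θ))) := by gcongr
    _ = √(Q⁻¹ * ∑ x, ‖f x‖ ^ 2) * (√7 * (E.card : ℝ) ^ (θ / 2)) := by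
        rw [Real.sqrt_mul hqn.le, Real.sqrt_mul (by norm_num : (0 : ℝ) ≤ 7), hNθ,
          Real.sqrt_mul (by positivity), Real.sqrt_inv]
        have : Q⁻¹ * √Q = (√Q)⁻¹ := by
          have h0 : √Q ≠ 0 := (Real.sqrt_pos.2 hqn).ne'
          field_simp
          exact Real.sq_sqrt hqn.le
        rw [← this]
        ring
    _ ≤ √(Q⁻¹ * ∑ x, ‖f x‖ ^ 2) * (3 * (E.card : ℝ) ^ (θ / 2)) := by
        gcongr
        rw [Real.sqrt_le_left (by norm_num)]
        norm_num
    _ = _ := by ring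

lemma lpCount_extension_le (hχ : χ.IsPrimitive) (hF : ringChar F ≠ 2) {k : ℕ} (hk : 1 ≤ k)
    (hn : n = 2 * k + 1) (f : paraboloid F (n + 1) → ℂ) {r : ℝ≥0∞} {β : ℝ}
    (hβ : 1 - β = (1 + 2 * (2 * k + 1) / (2 * k + 2 : ℝ) ^ 2) / 2) (hr1 : 1 ≤ r)
    (hr : r ≠ ∞ → 1 ≤ r.toReal * β) :
    lpCount r (extension χ (paraboloid F (n + 1)) f) ≤
      3 * lpAvg 2 f * (1 + (n + 1) * Real.log (Fintype.card F)) := by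
  have hy : 0 ≤ Real.log (Fintype.card F) := Real.log_nonneg one_le_card_field
  have hweak := sum_norm_extension_le hχ hF hk hn f
  rw [← hβ] at hweak
  have hM : 0 ≤ 3 * lpAvg 2 f := by rw [lpAvg_two]; positivity
  set M := 3 * lpAvg 2 f
  have hH1 : 1 ≤ 1 + (n + 1) * Real.log (Fintype.card F) := by
    have : 0 ≤ (n + 1) * Real.log (Fintype.card F) := by positivity
    linarith
  unfold lpCount
  split_ifs with htop
  · refine ciSup_le fun m => ?_
    -- For `r = ∞` one-point sets suffice, without loss.
    have := hweak {m}
    simp only [Finset.sum_singleton, Finset.card_singleton, Nat.cast_one, Real.one_rpow,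
      mul_one] at this
    exact this.trans (le_mul_of_one_le_right hM hH1)
  · have hR1 : 1 ≤ r.toReal := by
      rwa [← ENNReal.toReal_one, ENNReal.toReal_le_toReal ENNReal.one_ne_top htop]
    have hR0 : 0 < r.toReal := by linarith
    have h1 := sum_rpow_le_harmonic _ (fun m => norm_nonneg _) hM hR0 (hr htop) hweak Finset.univ
    have h2 : (harmonic (Finset.univ : Finset (Fin (n + 1) → F)).card : ℝ) ≤
        1 + (n + 1) * Real.log (Fintype.card F) := by
      refine (harmonic_le_one_add_log _).trans (le_of_eq ?_)
      simp [Finset.card_univ]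
    have hH0 : (0 : ℝ) ≤ 1 + (n + 1) * Real.log (Fintype.card F) := by linarith
    calc _ ≤ (M ^ r.toReal * (1 + (n + 1) * Real.log (Fintype.card F))) ^ (1 / r.toReal) := by
          apply Real.rpow_le_rpow (Finset.sum_nonneg fun _ _ => by positivity)
          · exact h1.trans (by gcongr)
          · positivity
      _ = M * (1 + (n + 1) * Real.log (Fintype.card F)) ^ (1 / r.toReal) := by
          rw [Real.mul_rpow (by positivity) hH0, one_div, Real.rpow_rpow_inv hM hR0.ne']
      _ ≤ M * (1 + (n + 1) * Real.log (Fintype.card F)) ^ (1 : ℝ) := by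
          gcongr
          rw [div_le_one hR0]
          exact hR1
      _ = _ := by rw [Real.rpow_one]

end Extension

end FiniteFieldExtension

/-! ### The extension theorem. -/

theorem theorem2p2 (d : ℕ) (hd : 4 ≤ d) (hd_even : Even d) (r : ℝ≥0∞)
    (hr : ENNReal.ofReal (2 * (d : ℝ) ^ 2 / ((d : ℝ) ^ 2 - 2 * (d : ℝ) + 2)) ≤ r)
    (ε : ℝ) (hε : 0 < ε) :
    ∃ C : ℝ, 0 < C ∧
      ∀ (F : Type*) [Field F] [Fintype F] [DecidableEq F], ringChar F ≠ 2 →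
        ∀ χ : AddChar F ℂ, χ ≠ 1 →
          FiniteFieldExtension.extensionConst χ (FiniteFieldExtension.paraboloid F d) 2 r ≤
            ENNReal.ofReal (C * (Fintype.card F : ℝ) ^ ε) := by
  obtain ⟨k, hk, rfl⟩ : ∃ k, 1 ≤ k ∧ d = 2 * k + 1 + 1 := by
    obtain ⟨j, hj⟩ := hd_even
    exact ⟨j - 1, by omega, by omega⟩
  set D : ℝ := ((2 * k + 1 + 1 : ℕ) : ℝ) with hD
  have hD4 : 4 ≤ D := by rw [hD]; exact_mod_cast hd
  have hDk : (2 * k + 2 : ℝ) = D := by rw [hD]; push_cast; ring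
  have hden : 0 < D ^ 2 - 2 * D + 2 := by nlinarith
  have hr0 : 1 ≤ 2 * D ^ 2 / (D ^ 2 - 2 * D + 2) := by
    rw [le_div_iff₀ hden]; nlinarith
  have hr1 : 1 ≤ r := by
    refine le_trans ?_ hr
    rw [← ENNReal.ofReal_one]
    exact ENNReal.ofReal_le_ofReal hr0
  -- The factor `1 + D / ε` comes from `1 ≤ q^ε` and `log q ≤ q^ε / ε`, applied to `1 + D log q`.
  refine ⟨3 * (1 + D / ε), by positivity, ?_⟩
  intro F _ _ _ hF χ hχ
  have hχ' := AddChar.IsPrimitive.of_ne_one hχ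
  have hq1 : (1 : ℝ) ≤ Fintype.card F := FiniteFieldExtension.one_le_card_field
  have hbound : ∀ f : FiniteFieldExtension.paraboloid F (2 * k + 1 + 1) → ℂ,
      FiniteFieldExtension.lpCount r (FiniteFieldExtension.extension χ
        (FiniteFieldExtension.paraboloid F (2 * k + 1 + 1)) f) ≤
      3 * (1 + D / ε) * (Fintype.card F : ℝ) ^ ε * FiniteFieldExtension.lpAvg 2 f := by
    intro f
    have h := FiniteFieldExtension.lpCount_extension_le hχ' hF hk rfl f (r := r)
      (β := (D ^ 2 - 2 * D + 2) / (2 * D ^ 2)) (by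
        rw [hDk, show (2 * k + 1 : ℝ) = D - 1 by linarith]
        field_simp
        ring) hr1 (by
        intro htop
        have h1 : 2 * D ^ 2 / (D ^ 2 - 2 * D + 2) ≤ r.toReal :=
          (ENNReal.ofReal_le_iff_le_toReal htop).1 hr
        rw [div_le_iff₀ hden] at h1
        rw [mul_div_assoc', le_div_iff₀ (by positivity)]
        linarith)
    refine h.trans ?_
    have hlog := Real.log_le_rpow_div (x := (Fintype.card F : ℝ)) (by positivity) hε
    have hqε : 1 ≤ (Fintype.card F : ℝ) ^ ε := Real.one_le_rpow hq1 hε.le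
    have hlp : 0 ≤ FiniteFieldExtension.lpAvg 2 f := by
      rw [FiniteFieldExtension.lpAvg_two]; positivity
    have hfac : 1 + ((2 * k + 1 : ℕ) + 1) * Real.log (Fintype.card F) ≤
        (1 + D / ε) * (Fintype.card F : ℝ) ^ ε := by
      have : (((2 * k + 1 : ℕ) : ℝ) + 1) = D := by rw [hD]; push_cast; ring
      rw [this]
      calc 1 + D * Real.log (Fintype.card F)
          ≤ (Fintype.card F : ℝ) ^ ε + D * ((Fintype.card F : ℝ) ^ ε / ε) := by gcongr
        _ = _ := by ring
    calc _ ≤ 3 * FiniteFieldExtension.lpAvg 2 f * ((1 + D / ε) * (Fintype.card F : ℝ) ^ ε) := by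
          gcongr
      _ = _ := by ring
  have hC : 0 ≤ 3 * (1 + D / ε) * (Fintype.card F : ℝ) ^ ε := by positivity
  refine iInf₂_le_of_le (Real.toNNReal (3 * (1 + D / ε) * (Fintype.card F : ℝ) ^ ε)) ?_ le_rfl
  intro f
  rw [Real.coe_toNNReal _ hC]
  exact hbound f
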